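/- **Excursions and solitons.** Let $\mathcal E$ be the set of finite excursions: nearest-neighbour walks $\varepsilon=(\varepsilon(0),\dots,\varepsilon(2n))$, $n\ge 0$, with $\varepsilon\ge 0$ and $\varepsilon(0)=\varepsilon(2n)=0$ (the empty excursion, $n=0$, included). An up-step at time $z$ is read as a ball in box $z$, a down-step as an empty box; all boxes of $\mathbb Z$ outside $\{1,\dots,2n\}$ are empty. The solitons of $\varepsilon$ are identified by the Takahashi–Satsuma algorithm: as long as there are finite runs (maximal segments of equal content), let $k$ be the size of the smallest one, take the leftmost run of size $k$, declare its $k$ boxes and the first $k$ boxes of the successive run to be a $k$-soliton, and then ignore these $2k$ boxes. Let $n_k(\varepsilon)$ be the number of $k$-solitons of $\varepsilon$. **Slot diagrams.** The head $h_0<\dots<h_{m-1}$ and the tail $t_0<\dots<t_{m-1}$ of an $m$-soliton are the positions of its balls and of its empty boxes. For $k\ge1$ the $k$-slots of $\varepsilon$ are the box $0$ and all boxes $h_i,t_i$ with $i\ge k$ of the $m$-solitons with $m>k$; they are numbered $0,\dots,s_k-1$ from left to right, and the box $2n+1$ counts as the next $k$-slot. Let $x_k(j)$ be the number of $k$-solitons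 that lie strictly between the $k$-slots number $j$ and $j+1$. The rows $x_k=(x_k(0),\dots,x_k(s_k-1))$ form the slot diagram $x[\varepsilon]$; put $|x_k|=\sum_{j<s_k}x_k(j)$. **First family.** For $\alpha=(\alpha_k)_{k\ge1}$ with $\alpha_k\in[0,1)$ let (with $0^0=1$) $$Z_\alpha=\sum_{\varepsilon\in\mathcal E}\prod_{k\ge1}\alpha_k^{n_k(\varepsilon)},\qquad \mathcal A=\{\alpha: Z_\alpha<\infty\},\qquad \nu_\alpha(\varepsilon)=\frac1{Z_\alpha}\prod_{k\ge1}\alpha_k^{n_k(\varepsilon)}\quad(\alpha\in\mathcal A),$$ and let $\mathcal A^+$ be the set of $\alpha\in\mathcal A$ with finite mean excursion length, $\sum_{k\ge1}2k\sum_{\varepsilon}n_k(\varepsilon)\,\nu_\alpha(\varepsilon)<\infty$. **Second family.** For $q=(q_k)_{k\ge1}$ with $q_k\in[0,1)$ let $\mathcal Q=\{q:\sum_k q_k<\infty\}$, $\mathcal Q^+=\{q:\sum_k kq_k<\infty\}$ and, for $q\in\mathcal Q$, $$\varphi_q(\varepsilon)=\prod_{k\ge1}q_k^{|x_k[\varepsilon]|}(1-q_k)^{s_k(x[\varepsilon])}.$$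 **Change of parameters.** Let $q=q(\alpha)$ and $\alpha=\alpha(q)$ be given by $$q_1=\alpha_1,\quad q_k=\frac{\alpha_k}{\prod_{j=1}^{k-1}(1-q_j)^{2(k-j)}}\ (k\ge2),\qquad\qquad \alpha_k=q_k\prod_{\ell=1}^{k-1}(1-q_\ell)^{2(k-\ell)}\ (k\ge1).$$ **Theorem (Equivalence of measures).** Let $\alpha$ and $q$ be related in this way, through $q=q(\alpha)$ for a given $\alpha\in[0,1)^{\mathbb N}$ or through $\alpha=\alpha(q)$ for a given $q\in[0,1)^{\mathbb N}$. (If a denominator in the recursion for $q(\alpha)$ vanishes, then some $q_j=1$ and $q(\alpha)$ counts as not belonging to $\mathcal Q$.) Then $\alpha\in\mathcal A$ if and only if $q\in\mathcal Q$, and $\alpha\in\mathcal A^+$ if and only if $q\in\mathcal Q^+$. The two transformations are inverse to each other ($q(\alpha(q))=q$ for every $q\in[0,1)^{\mathbb N}$, and $\alpha(q(\alpha))=\alpha$ for every $\alpha\in[0,1)^{\mathbb N}$ with $q(\alpha)\in[0,1)^{\mathbb N}$) and map bijectively $\mathcal A\leftrightarrow\mathcal Q$ and $\mathcal A^+\leftrightarrow\mathcal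 Q^+$. Furthermore, $\nu_\alpha=\varphi_{q(\alpha)}$ for every $\alpha\in\mathcal A$ and $\varphi_q=\nu_{\alpha(q)}$ for every $q\in\mathcal Q$, and these are probability measures on $\mathcal E$. -/

import Mathlib

open scoped ENNReal

namespace BoxBall

/-! ### Excursions, solitons, slots -/

/-- Finite soft excursions: non-negative nearest-neighbour walks of even length that start and end
at zero, given by their steps. An up-step `U` at time `z` is a ball in box `z`, a down-step `D` is an
empty box; the boxes outside of the excursion are empty. -/
abbrev Excursion := DyckWord

/-- A box: its content and its position. -/
abbrev Box := DyckStep × ℕ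

/-- The boxes `1, …, 2n` of an excursion of length `2n`. -/
def boxes (ε : Excursion) : List Box := ε.toList.zipIdx 1

/-- The maximal runs of equal contents of a list of boxes, from left to right. -/
def runs (l : List Box) : List (List Box) := l.splitBy fun a b => decide (a.1 = b.1)

/-- In a list of runs, the leftmost run that has size `k` and a successor, together with the first
`k` boxes of the successive run. -/
def takeSoliton (k : ℕ) : List (List Box) → Option (List Box)
  | r :: r' :: rs => if r.length = k then some (r ++ r'.take k) else takeSoliton k (r' :: rs)
  | _ => none

/-- One round of the Takahashi–Satsuma algorithm. The last run of a non-empty excursion consists of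
empty boxes and continues to infinity, so that the finite runs are all runs but the last. Here `k` is
the size of the smallest finite run; there is no soliton if there is no finite run. -/
def nextSoliton (l : List Box) : Option (List Box) :=
  match ((runs l).dropLast.map List.length).min? with
  | none => none
  | some k => takeSoliton k (runs l)

/-- At most `n` rounds of the Takahashi–Satsuma algorithm; the boxes of a soliton are ignored once
the soliton has been identified. -/
def identify : ℕ → List Box → List (List Box)
  | 0, _ => []
  | n + 1, l =>
    match nextSoliton l with
    | none => []
    | some γ => γ :: identify n (l.filter fun b => decide (b ∉ γ))

/-- All solitons of an excursion, each as the list of its boxes from left to right. (Every round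
removes at least two boxes, so that the bound on the number of rounds is never active.) -/
def solitons (ε : Excursion) : List (List Box) := identify (boxes ε).length (boxes ε)

/-- The `k`-solitons of an excursion: the solitons made of `k` balls and `k` empty boxes. -/
def solitonsOfSize (ε : Excursion) (k : ℕ) : List (List Box) :=
  (solitons ε).filter fun γ => decide (γ.length = 2 * k)

/-- The number `n_k(ε)` of `k`-solitons of `ε`. -/
def numSolitons (ε : Excursion) (k : ℕ) : ℕ := (solitonsOfSize ε k).length

/-- Positions `h_0 < h_1 < …` of the head (the balls) of a soliton. -/
def head (γ : List Box) : List ℕ := (γ.filter fun b => decide (b.1 = DyckStep.U)).map Prod.snd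

/-- Positions `t_0 < t_1 < …` of the tail (the empty boxes) of a soliton. -/
def tail (γ : List Box) : List ℕ := (γ.filter fun b => decide (b.1 = DyckStep.D)).map Prod.snd

/-- The `k`-slots of an excursion, from left to right: record `0` (position `0`), and all `h_i(γ)` and
`t_i(γ)` with `i ≥ k` of all solitons `γ` (necessarily of size larger than `k`). -/
def slots (ε : Excursion) (k : ℕ) : List ℕ :=
  (List.range ((boxes ε).length + 1)).filter fun z =>
    decide (z = 0 ∨ ∃ γ ∈ solitons ε, z ∈ (head γ).drop k ∨ z ∈ (tail γ).drop k)

/-- Position of the `k`-slot number `j`. After the last `k`-slot of the excursion comes the one at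
record `1`, the box just after the excursion. -/
def slotPos (ε : Excursion) (k j : ℕ) : ℕ := (slots ε k).getD j ((boxes ε).length + 1)

/-- The soliton `γ` is appended to the `k`-slot number `j`: it lies strictly between the `k`-slots
number `j` and `j + 1`. -/
def Appended (ε : Excursion) (k j : ℕ) (γ : List Box) : Prop :=
  ∀ b ∈ γ, slotPos ε k j < b.2 ∧ b.2 < slotPos ε k (j + 1)

instance (ε : Excursion) (k j : ℕ) (γ : List Box) : Decidable (Appended ε k j γ) := by
  unfold Appended; infer_instance

/-- Row `x_k = (x_k(0), …, x_k(s_k - 1))` of the slot diagram of `ε`, where `s_k` is the number of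
`k`-slots and `x_k(j)` the number of `k`-solitons appended to the `k`-slot number `j`. -/
def slotRow (ε : Excursion) (k : ℕ) : List ℕ :=
  (List.range (slots ε k).length).map fun j =>
    ((solitonsOfSize ε k).filter fun γ => decide (Appended ε k j γ)).length

/-! ### The two families of measures -/

/-- Families of parameters in `[0, 1)`. -/
def params : Set (ℕ+ → ℝ) := {a | ∀ k, a k ∈ Set.Ico (0 : ℝ) 1}

/-- The weight `∏ α_k ^ n_k(ε)`, a product with finitely many factors different from `1`. -/
noncomputable def weight (α : ℕ+ → ℝ) (ε : Excursion) : ℝ≥0∞ :=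
  ENNReal.ofReal (∏ᶠ k : ℕ+, α k ^ numSolitons ε k)

/-- The partition function `Z_α`. -/
noncomputable def Z (α : ℕ+ → ℝ) : ℝ≥0∞ := ∑' ε : Excursion, weight α ε

/-- Parameters with finite partition function. -/
def setA : Set (ℕ+ → ℝ) := {α | α ∈ params ∧ Z α < ⊤}

/-- The law `ν_α` on excursions, given by its point masses. -/
noncomputable def nu (α : ℕ+ → ℝ) (ε : Excursion) : ℝ≥0∞ := weight α ε / Z α

/-- The mean number `ρ_k(α)` of `k`-solitons under `ν_α`. -/
noncomputable def rho (α : ℕ+ → ℝ) (k : ℕ+) : ℝ≥0∞ :=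
  ∑' ε : Excursion, (numSolitons ε k : ℝ≥0∞) * nu α ε

/-- Parameters with finite mean excursion length. -/
def setAplus : Set (ℕ+ → ℝ) := {α | α ∈ setA ∧ ∑' k : ℕ+, 2 * (k : ℝ≥0∞) * rho α k < ⊤}

/-- Parameters `q` with finite sum. -/
def setQ : Set (ℕ+ → ℝ) := {q | q ∈ params ∧ Summable q}

/-- Parameters `q` with `∑ k q_k` finite. -/
def setQplus : Set (ℕ+ → ℝ) := {q | q ∈ params ∧ Summable fun k : ℕ+ => (k : ℝ) * q k}

/-- The law `φ_q` on excursions, given by its point masses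
`∏ q_k ^ |x_k| * (1 - q_k) ^ s_k`, where `x` is the slot diagram of the excursion, `|x_k|` the sum and
`s_k` the number of the entries of the row `x_k`. -/
noncomputable def phi (q : ℕ+ → ℝ) (ε : Excursion) : ℝ≥0∞ :=
  ENNReal.ofReal (∏' k : ℕ+, q k ^ (slotRow ε k).sum * (1 - q k) ^ (slotRow ε k).length)

/-! ### The change of parameters -/

/-- `q(α)`, by recursion:
`q_1 = α_1` and `q_k = α_k / ∏_{1 ≤ j < k} (1 - q_j) ^ (2 (k - j))`; see `qOf_eq`. -/
noncomputable def qOf (α : ℕ+ → ℝ) (k : ℕ+) : ℝ :=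
  α k / ∏ j : {j : ℕ+ // j ∈ Finset.Ico 1 k}, (1 - qOf α j.1) ^ (2 * ((k : ℕ) - (j.1 : ℕ)))
termination_by (k : ℕ)
decreasing_by exact (Finset.mem_Ico.mp j.2).2

theorem qOf_eq (α : ℕ+ → ℝ) (k : ℕ+) :
    qOf α k = α k / ∏ j ∈ Finset.Ico 1 k, (1 - qOf α j) ^ (2 * ((k : ℕ) - (j : ℕ))) := by
  rw [qOf, ← Finset.prod_coe_sort (Finset.Ico 1 k)
    (fun j : ℕ+ => (1 - qOf α j) ^ (2 * ((k : ℕ) - (j : ℕ))))]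

/-- `α(q)`, given by `α_k = q_k ∏_{1 ≤ l < k} (1 - q_l) ^ (2 (k - l))`. -/
noncomputable def alphaOf (q : ℕ+ → ℝ) (k : ℕ+) : ℝ :=
  q k * ∏ l ∈ Finset.Ico 1 k, (1 - q l) ^ (2 * ((k : ℕ) - (l : ℕ)))

end BoxBall

namespace BoxBall
open DyckStep

/-! The engine is peak elimination: `elim` deletes all factors `U D` of a word at once. It turns
every `k + 1`-soliton into a `k`-soliton and destroys the `1`-solitons. To see this, follow one
round of the Takahashi–Satsuma algorithm. Removal of a soliton of size `k + 1` becomes, after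
`elim`, removal of one of size `k`, and it costs exactly one peak (`Removal.elim`,
`Removal.peaks_eq`). So `elim^[j] ε` has as many peaks as `ε` has solitons larger than `j`, and the
soliton numbers are differences of peak numbers (`numSolitons_succ`).

The words that reduce to a given `v` arise by free choice of a number of extra peaks in each of the
`|v| + 1` gaps of `v`. With weight `t` per `1`-soliton they sum to `(1 - t)⁻¹ ^ (|v| + 1)`
(`fibreSum_pow`). Since `|v|` is the sum of `2 m n_m(v)`, this factor is absorbed into the
parameters of the larger solitons, and `Z` becomes `(1 - α_1)⁻¹` times the partition function of the
shifted parameters (`markedSum_step`). In the coordinates `q` that shift just drops `q_1`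
(`shiftParam_alphaSeq`), so `Z` is the product of the `(1 - q_k)⁻¹` (`partition_eq_iSup`), which is
finite exactly if the `q_k` are summable. If some `q_k ≥ 1`, then `Z` is infinite
(`partition_eq_top`).

For the mean length the same recursion carries a linear statistic of the soliton numbers, which
stays linear because the mean number of extra peaks is affine in `|v|`. Upper and lower bounds on
its constant term compare it with the sum of `k q_k`.

For the laws, the nesting of the solitons gives `|x_k| = n_k` (`sum_slotRow`) and `s_k = 1 + ∑ 2 (m
- k) n_m`, summed over `m > k` (`length_slotRow`). Regrouping the factors turns `φ_q` into the
weight for `α(q)` times the product of the `1 - q_k`, that is, times `1 / Z` (`phi_eq`,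
`inv_Z_alphaOf`). -/

/-! ### Peak elimination on words. -/

/-- Remove all peaks of a word simultaneously. -/
def elim : List DyckStep → List DyckStep
  | U :: D :: l => elim l
  | a :: l => a :: elim l
  | [] => []

/-- The number of peaks of a word. -/
def peaks : List DyckStep → ℕ
  | U :: D :: l => peaks l + 1
  | _ :: l => peaks l
  | [] => 0

@[simp] theorem elim_nil : elim [] = [] := by simp [elim]
@[simp] theorem elim_UD (l) : elim (U :: D :: l) = elim l := by simp [elim]
@[simp] theorem elim_D (l) : elim (D :: l) = D :: elim l := by simp [elim]
@[simp] theorem elim_UU (l) : elim (U :: U :: l) = U :: elim (U :: l) := by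
  rw [elim]; simp
@[simp] theorem elim_U : elim [U] = [U] := by simp [elim]
@[simp] theorem peaks_nil : peaks [] = 0 := by simp [peaks]
@[simp] theorem peaks_UD (l) : peaks (U :: D :: l) = peaks l + 1 := by simp [peaks]
@[simp] theorem peaks_D (l) : peaks (D :: l) = peaks l := by simp [peaks]
@[simp] theorem peaks_UU (l) : peaks (U :: U :: l) = peaks (U :: l) := by
  rw [peaks]; simp
@[simp] theorem peaks_U : peaks [U] = 0 := by simp [peaks]

/-- Induction that reads a word from left to right, peak by peak. -/
theorem word_induction {P : List DyckStep → Prop} (nil : P []) (single : P [U])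
    (hD : ∀ l, P l → P (D :: l)) (hUU : ∀ l, P (U :: l) → P (U :: U :: l))
    (hUD : ∀ l, P l → P (U :: D :: l)) : ∀ l, P l
  | [] => nil
  | [U] => single
  | D :: l => hD l (word_induction nil single hD hUU hUD l)
  | U :: U :: l => hUU l (word_induction nil single hD hUU hUD (U :: l))
  | U :: D :: l => hUD l (word_induction nil single hD hUU hUD l)

/-- No peak straddles a cut in front of a `U` or behind a `D`, so `elim` and `peaks` split at such
cuts. -/
theorem elim_append_U (c b) : elim (c ++ U :: b) = elim c ++ elim (U :: b) := by
  induction c using word_induction <;> simp_all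

theorem elim_append_D (c b) : elim (c ++ D :: b) = elim (c ++ [D]) ++ elim b := by
  induction c using word_induction <;> simp_all

theorem peaks_append_U (c b) : peaks (c ++ U :: b) = peaks c + peaks (U :: b) := by
  induction c using word_induction <;> simp_all; omega

theorem peaks_append_D (c b) : peaks (c ++ D :: b) = peaks (c ++ [D]) + peaks b := by
  induction c using word_induction <;> simp_all <;> omega

theorem elim_replicate_D (k l) : elim (.replicate k D ++ l) = .replicate k D ++ elim l := by
  induction k <;> simp_all [List.replicate_succ]

theorem elim_replicate_U (k l) :
    elim (.replicate (k + 1) U ++ l) = .replicate k U ++ elim (U :: l) := by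
  induction k <;> simp_all [List.replicate_succ]

theorem peaks_replicate_D (k l) : peaks (.replicate k D ++ l) = peaks l := by
  induction k <;> simp_all [List.replicate_succ]

theorem peaks_replicate_U (k l) : peaks (.replicate (k + 1) U ++ l) = peaks (U :: l) := by
  induction k <;> simp_all [List.replicate_succ]

/-! ### Removal of one soliton commutes with peak elimination. -/

/-- `Removal k w w'`: the word `w'` arises from `w` by removal of a block of `k` equal steps and the
following `k` opposite steps, where the block starts the word or follows `k` opposite steps. -/
inductive Removal (k : ℕ) : List DyckStep → List DyckStep → Prop
  | first (b) : Removal k (.replicate k U ++ (.replicate k D ++ b)) b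
  | peak (c b) : Removal k (c ++ (.replicate k D ++ (.replicate k U ++ (.replicate k D ++ b))))
      (c ++ (.replicate k D ++ b))
  | valley (c b) : Removal k (c ++ (.replicate k U ++ (.replicate k D ++ (.replicate k U ++ b))))
      (c ++ (.replicate k U ++ b))

theorem elim_block (k b) : elim (.replicate (k + 1) U ++ (.replicate (k + 1) D ++ b)) =
    .replicate k U ++ (.replicate k D ++ elim b) := by
  rw [elim_replicate_U, List.replicate_succ, List.cons_append, elim_UD, elim_replicate_D]

theorem peaks_block (k b) : peaks (.replicate (k + 1) U ++ (.replicate (k + 1) D ++ b)) =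
    peaks b + 1 := by
  rw [peaks_replicate_U, List.replicate_succ, List.cons_append, peaks_UD, peaks_replicate_D]

theorem elim_append_replicate_D (c k b) : elim (c ++ (.replicate (k + 1) D ++ b)) =
    elim (c ++ [D]) ++ (.replicate k D ++ elim b) := by
  rw [List.replicate_succ, List.cons_append, elim_append_D, elim_replicate_D]

theorem peaks_append_replicate_D (c k b) : peaks (c ++ (.replicate (k + 1) D ++ b)) =
    peaks (c ++ [D]) + peaks b := by
  rw [List.replicate_succ, List.cons_append, peaks_append_D, peaks_replicate_D]

theorem elim_append_replicate_U (c k b) : elim (c ++ (.replicate (k + 1) U ++ b)) =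
    elim c ++ elim (.replicate (k + 1) U ++ b) := by
  rw [List.replicate_succ, List.cons_append, elim_append_U]

theorem peaks_append_replicate_U (c k b) : peaks (c ++ (.replicate (k + 1) U ++ b)) =
    peaks c + peaks (.replicate (k + 1) U ++ b) := by
  rw [List.replicate_succ, List.cons_append, peaks_append_U]

/-- A block `U … U D … D` has a single peak, whose elimination shortens both halves by one. The
neighbouring `k + 1` equal steps provide a safe cut; one of them goes into the context `c` or `b`,
and the other `k` survive as the neighbours that the smaller removal needs. -/
theorem Removal.elim {k w w'} (h : Removal (k + 1) w w') :
    Removal k (elim w) (BoxBall.elim w') := by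
  cases h with
  | first b => rw [elim_block]; exact .first _
  | peak c b =>
    rw [elim_append_replicate_D, elim_block, elim_append_replicate_D]; exact .peak _ _
  | valley c b =>
    rw [elim_append_replicate_U, elim_append_replicate_U, elim_block, elim_replicate_U]
    exact .valley _ _

theorem Removal.peaks_eq {k w w'} (h : Removal (k + 1) w w') : peaks w = peaks w' + 1 := by
  cases h with
  | first b => rw [peaks_block]
  | peak c b => rw [peaks_append_replicate_D, peaks_block, peaks_append_replicate_D]; rfl
  | valley c b => rw [peaks_append_replicate_U, peaks_append_replicate_U, peaks_block]; rfl

theorem Removal.eq_of_zero {w w'} (h : Removal 0 w w') : w = w' := by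
  cases h <;> simp

/-- Each elimination lowers the size of the removed soliton by one; as long as the size is positive
the removal costs one peak, and at size zero the two words agree. -/
theorem Removal.peaks_iterate {k w w'} (h : Removal k w w') (j : ℕ) :
    peaks (BoxBall.elim^[j] w) = peaks (BoxBall.elim^[j] w') + if j < k then 1 else 0 := by
  induction j generalizing k w w' with
  | zero => cases k with
    | zero => simp [h.eq_of_zero]
    | succ k => simp [h.peaks_eq]
  | succ j ih => cases k with
    | zero => simp [h.eq_of_zero]
    | succ k => simpa using ih h.elim

/-! ### Non-negative walks and their invariance under elimination and removal. -/

/-- The word is a non-negative walk from height `h` to height `0`. -/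
def Descends : ℕ → List DyckStep → Prop
  | h, [] => h = 0
  | h, U :: l => Descends (h + 1) l
  | 0, D :: _ => False
  | h + 1, D :: l => Descends h l

theorem descends_elim (h w) : Descends h (elim w) ↔ Descends h w := by
  induction w using word_induction generalizing h with
  | nil => simp
  | single => simp
  | hD l ih => cases h <;> simp_all [Descends]
  | hUU l ih => simp_all [Descends]
  | hUD l ih => simp_all [Descends]

theorem descends_replicate_U (k h b) :
    Descends h (.replicate k U ++ b) ↔ Descends (h + k) b := by
  induction k generalizing h with
  | zero => simp
  | succ k ih => simp [List.replicate_succ, Descends, ih, add_assoc, add_comm 1]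

theorem descends_replicate_D (k h b) :
    Descends (h + k) (.replicate k D ++ b) ↔ Descends h b := by
  induction k generalizing h with
  | zero => simp
  | succ k ih => simp [List.replicate_succ, Descends, ih, ← add_assoc]

theorem descends_append_congr {b b'} (H : ∀ h, Descends h b ↔ Descends h b') (c h) :
    Descends h (c ++ b) ↔ Descends h (c ++ b') := by
  induction c generalizing h with
  | nil => exact H h
  | cons a c ih => cases a <;> cases h <;> simp [Descends, ih]

theorem descends_block (k h b) :
    Descends h (.replicate k U ++ (.replicate k D ++ b)) ↔ Descends h b := by
  rw [descends_replicate_U, descends_replicate_D]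

theorem Removal.descends_iff {k w w'} (r : Removal k w w') (h) : Descends h w ↔ Descends h w' := by
  cases r with
  | first b => exact descends_block _ _ _
  | peak c b =>
    exact descends_append_congr (descends_append_congr (fun h => descends_block _ _ _) _) _ _
  | valley c b => exact descends_append_congr (fun h => descends_block _ _ _) _ _

theorem descends_iff (h w) : Descends h w ↔ w.count U + h = w.count D ∧
    ∀ i, (w.take i).count D ≤ (w.take i).count U + h := by
  induction w generalizing h with
  | nil => simp [Descends]
  | cons a l ih =>
    have key : (∀ i, ((a :: l).take i).count D ≤ ((a :: l).take i).count U + h) ↔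
        ∀ i, ((a :: l.take i)).count D ≤ ((a :: l.take i)).count U + h :=
      ⟨fun H i => by simpa using H (i + 1), fun H i => by
        cases i with
        | zero => simp
        | succ i => simpa using H i⟩
    rw [key]
    cases a with
    | U =>
      simp only [Descends, ih, List.count_cons]
      simp only [beq_self_eq_true, if_true, show (U == D) = false from rfl, Bool.false_eq_true,
        if_false, add_zero]
      refine and_congr (by omega) (forall_congr' fun i => by omega)
    | D =>
      cases h with
      | zero =>
        simp only [Descends, false_iff, not_and]
        intro _ H
        simpa using H 0
      | succ h =>
        simp only [Descends, ih, List.count_cons]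
        simp only [beq_self_eq_true, if_true, show (D == U) = false from rfl, Bool.false_eq_true,
          if_false, add_zero]
        refine and_congr (by omega) (forall_congr' fun i => by omega)

theorem descends_toList (ε : Excursion) : Descends 0 ε.toList :=
  (descends_iff _ _).2 ⟨ε.count_U_eq_count_D, ε.count_D_le_count_U⟩

/-- Excursions as words. -/
def excursionEquiv : Excursion ≃ {w // Descends 0 w} where
  toFun ε := ⟨ε.toList, descends_toList ε⟩
  invFun w := ⟨w.1, ((descends_iff _ _).1 w.2).1, ((descends_iff _ _).1 w.2).2⟩
  left_inv _ := rfl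
  right_inv _ := rfl

/-- This makes the natural subtraction in `ones` an honest one. The second half serves the case `U
:: U :: l`, in which the surviving `U` may form a new peak with the reduced rest. -/
theorem peaks_elim_le (w) : peaks (elim w) ≤ peaks w ∧ peaks (U :: elim w) ≤ peaks (U :: w) := by
  induction w using word_induction with
  | nil => simp
  | single => simp
  | hD l ih => simp_all
  | hUU l ih => simp_all
  | hUD l ih =>
    simp only [elim_UD, peaks_UD, peaks_UU]
    refine ⟨by omega, ?_⟩
    rcases h : elim l with _ | ⟨_ | _, t⟩
    · simp
    · rw [h] at ih; simp at ih ⊢; omega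
    · rw [h] at ih; simp at ih ⊢; omega

/-- The number of peaks that are not restored from the peaks of the reduced word; for an excursion
this is its number of `1`-solitons. -/
def ones (w : List DyckStep) : ℕ := peaks w - peaks (elim w)

@[simp] theorem ones_nil : ones [] = 0 := by simp [ones]
@[simp] theorem ones_D (l) : ones (D :: l) = ones l := by simp [ones]
@[simp] theorem ones_UD (l) : ones (U :: D :: l) = ones l + 1 := by
  have := (peaks_elim_le l).1
  simp only [ones, elim_UD, peaks_UD]; omega

/-! ### Runs and a single round of the Takahashi–Satsuma algorithm. -/

/-- The steps of a list of boxes. -/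
def word (l : List Box) : List DyckStep := l.map Prod.fst

@[simp] theorem word_append (l l') : word (l ++ l') = word l ++ word l' := List.map_append
@[simp] theorem word_nil : word [] = [] := rfl
@[simp] theorem length_word (l) : (word l).length = l.length := by simp [word]

/-- The common content of the boxes of a run. -/
def content (r : List Box) : Option DyckStep := r.head?.map Prod.fst

/-- A decomposition into maximal runs of equal contents. -/
structure IsRuns (rs : List (List Box)) : Prop where
  const : ∀ r ∈ rs, ∃ X, r ≠ [] ∧ word r = .replicate r.length X
  alt : (rs.map content).IsChain (· ≠ ·)

theorem content_eq {r : List Box} {X} (h0 : r ≠ []) (h : word r = .replicate r.length X) :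
    content r = some X := by
  cases r with
  | nil => exact absurd rfl h0
  | cons b r =>
    simp [word, List.replicate_succ] at h
    simp [content, h.1]

theorem word_eq_replicate_of_isChain {r : List Box}
    (h : r.IsChain fun a b => decide (a.1 = b.1) = true) (h0 : r ≠ []) :
    word r = .replicate r.length (r.head h0).1 := by
  induction r with
  | nil => exact absurd rfl h0
  | cons a r ih =>
    cases r with
    | nil => simp [word]
    | cons b r =>
      rw [List.isChain_cons_cons] at h
      have := ih h.2 (by simp)
      simp only [List.head_cons, decide_eq_true_eq] at this h ⊢
      rw [List.length_cons, List.replicate_succ, h.1, ← this, ← h.1]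
      rfl

theorem isRuns_runs (l) : IsRuns (runs l) := by
  have hc : ∀ r ∈ runs l, ∃ X, r ≠ [] ∧ word r = .replicate r.length X := fun r hr =>
    have h0 := List.ne_nil_of_mem_splitBy hr
    ⟨_, h0, word_eq_replicate_of_isChain (List.isChain_of_mem_splitBy hr) h0⟩
  refine ⟨hc, ?_⟩
  rw [List.isChain_map]
  have := List.isChain_getLast_head_splitBy (fun a b : Box => decide (a.1 = b.1)) l
  refine List.IsChain.imp_of_mem_imp ?_ this
  rintro r r' hr hr' ⟨h0, h0', h⟩ he
  obtain ⟨X, -, hX⟩ := hc r hr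
  obtain ⟨Y, -, hY⟩ := hc r' hr'
  rw [content_eq h0 hX, content_eq h0' hY] at he
  have h1 := (List.eq_replicate_iff.1 hX).2 (r.getLast h0).1
    (List.mem_map_of_mem (List.getLast_mem h0))
  have h2 := (List.eq_replicate_iff.1 hY).2 (r'.head h0').1
    (List.mem_map_of_mem (List.head_mem h0'))
  simp_all

theorem IsRuns.runs_flatten {rs} (h : IsRuns rs) : runs rs.flatten = rs := by
  refine List.splitBy_flatten (fun h0 => ?_) (fun r hr => ?_) ?_
  · obtain ⟨_, h1, _⟩ := h.const _ h0
    exact h1 rfl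
  · obtain ⟨X, -, hX⟩ := h.const r hr
    refine List.Pairwise.isChain (List.pairwise_of_forall_mem_list fun a ha b hb => ?_)
    have h1 := (List.eq_replicate_iff.1 hX).2 a.1 (List.mem_map_of_mem ha)
    have h2 := (List.eq_replicate_iff.1 hX).2 b.1 (List.mem_map_of_mem hb)
    simp [h1, h2]
  · refine List.IsChain.imp_of_mem_imp ?_ ((List.isChain_map _).1 h.alt)
    intro r r' hr hr' hne
    obtain ⟨X, h0, hX⟩ := h.const r hr
    obtain ⟨Y, h0', hY⟩ := h.const r' hr'
    rw [content_eq h0 hX, content_eq h0' hY] at hne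
    have h1 := (List.eq_replicate_iff.1 hX).2 (r.getLast h0).1
      (List.mem_map_of_mem (List.getLast_mem h0))
    have h2 := (List.eq_replicate_iff.1 hY).2 (r'.head h0').1
      (List.mem_map_of_mem (List.head_mem h0'))
    exact ⟨h0, h0', by simp_all⟩

theorem flatten_runs (l) : (runs l).flatten = l := List.flatten_splitBy _ _

theorem exists_of_takeSoliton {k rs γ} (h : takeSoliton k rs = some γ) :
    ∃ pre r r' post, rs = pre ++ r :: r' :: post ∧ r.length = k ∧ γ = r ++ r'.take k := by
  induction rs with
  | nil => simp [takeSoliton] at h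
  | cons r rs ih =>
    cases rs with
    | nil => simp [takeSoliton] at h
    | cons r' rs =>
      rw [takeSoliton] at h
      split_ifs at h with hk
      · exact ⟨[], r, r', rs, rfl, hk, by simpa using h.symm⟩
      · obtain ⟨pre, s, s', post, h1, h2⟩ := ih h
        exact ⟨r :: pre, s, s', post, by rw [h1]; rfl, h2⟩

theorem takeSoliton_ne_none {k rs} (h : k ∈ (rs.dropLast).map List.length) :
    takeSoliton k rs ≠ none := by
  induction rs with
  | nil => simp at h
  | cons r rs ih =>
    cases rs with
    | nil => simp at h
    | cons r' rs =>
      rw [takeSoliton]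
      split_ifs with hk
      · simp
      · refine ih ?_
        simp only [List.dropLast_cons_cons, List.map_cons, List.mem_cons] at h
        exact h.resolve_left (Ne.symm hk)

theorem descends_of_append {c b h} (H : Descends h (c ++ b)) : ∃ h', Descends h' b := by
  induction c generalizing h with
  | nil => exact ⟨h, H⟩
  | cons a c ih => cases a <;> cases h <;> simp [Descends] at H <;> exact ih H

theorem le_of_descends_replicate_D {m h b} (H : Descends h (.replicate m D ++ b)) : m ≤ h := by
  induction m generalizing h with
  | zero => simp
  | succ m ih => cases h with
    | zero => simp [List.replicate_succ, Descends] at H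
    | succ h =>
      simp only [List.replicate_succ, List.cons_append, Descends] at H
      exact Nat.succ_le_succ (ih H)

theorem eq_of_descends_replicate_D {m h} (H : Descends h (.replicate m D)) : m = h := by
  have h1 : m ≤ h := le_of_descends_replicate_D (b := []) (by simpa using H)
  obtain ⟨d, rfl⟩ := Nat.exists_eq_add_of_le' h1
  have := (descends_replicate_D m d []).1 (by simpa using H)
  simp [Descends] at this; omega

theorem eq_zero_of_descends_replicate_U {m h} (H : Descends h (.replicate m U)) : m = 0 := by
  have := (descends_replicate_U m h []).1 (by simpa using H)
  simp [Descends] at this; omega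

/-- All finite runs have at least `k` boxes. -/
def MinRun (k : ℕ) (l : List Box) : Prop := ∀ r ∈ (runs l).dropLast, k ≤ r.length

/-- `l'` arises from `l` by removal of the soliton `γ` of size `k`. -/
structure Identifies (k : ℕ) (γ l l' : List Box) : Prop where
  pos : 1 ≤ k
  split : ∃ a b, l = a ++ (γ ++ b) ∧ l' = a ++ b
  word_eq : word γ = .replicate k U ++ .replicate k D ∨ word γ = .replicate k D ++ .replicate k U
  removal : Removal k (word l) (word l')
  minRun : MinRun k l'

theorem step_eq_of_ne {X Y Z : DyckStep} (h : X ≠ Y) (h' : Z ≠ Y) : X = Z := by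
  cases X <;> cases Y <;> cases Z <;> simp_all

theorem isRuns_of_suffix {pre post} (h : IsRuns (pre ++ post)) : IsRuns post :=
  ⟨fun r hr => h.const r (by simp [hr]),
    (List.isChain_append.1 (by simpa using h.alt)).2.1⟩

theorem minRun_flatten {rs k} (h : IsRuns rs) (H : ∀ r ∈ rs.dropLast, k ≤ r.length) :
    MinRun k rs.flatten := by
  unfold MinRun; rwa [h.runs_flatten]

/-- The run after a smallest finite run is long enough. -/
theorem length_next_run {k X Y m pre post} (hX : X ≠ Y) (hm : m ≠ 0)
    (hd : Descends 0 (pre ++ (.replicate k X ++ (.replicate m Y ++ post))))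
    (h : post ≠ [] → k ≤ m) : k ≤ m := by
  by_cases hp : post = []
  · subst hp
    obtain ⟨h', H⟩ := descends_of_append hd
    rw [List.append_nil] at H
    cases X <;> cases Y <;> try exact absurd rfl hX
    · rw [descends_replicate_U] at H
      have := eq_of_descends_replicate_D H
      omega
    · obtain ⟨h'', H⟩ := descends_of_append H
      exact absurd (eq_zero_of_descends_replicate_U H) hm
  · exact h hp

/-- Minimality of `k` makes the runs on both sides of `r` long enough for a `Removal`. What is left
of `r'` merges with the run before `r`, so no finite run shorter than `k` is created. -/
theorem identifies_of_runs {k pre r r' post} (hr : IsRuns (pre ++ r :: r' :: post))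
    (hd : Descends 0 (word (pre ++ r :: r' :: post).flatten)) (hk : r.length = k)
    (hmin : ∀ s ∈ (pre ++ r :: r' :: post).dropLast, k ≤ s.length) :
    Identifies k (r ++ r'.take k) (pre ++ r :: r' :: post).flatten
      (pre.flatten ++ (r'.drop k ++ post.flatten)) := by
  obtain ⟨X, h0, hX⟩ := hr.const r (by simp)
  obtain ⟨Y, h0', hY⟩ := hr.const r' (by simp)
  have hXY : X ≠ Y := by
    have := (isRuns_of_suffix hr).alt
    simp only [List.map_cons, List.isChain_cons_cons, content_eq h0 hX, content_eq h0' hY] at this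
    simpa using this.1
  have hfl : (pre ++ r :: r' :: post).flatten = pre.flatten ++ (r ++ (r' ++ post.flatten)) := by simp
  rw [hk] at hX
  have hkm : k ≤ r'.length := by
    rw [hfl] at hd
    simp only [word_append, hX, hY] at hd
    refine length_next_run hXY (by simpa using h0') hd fun hp => hmin r' ?_
    have : post ≠ [] := by rintro rfl; simp at hp
    rw [show pre ++ r :: r' :: post = pre ++ [r, r'] ++ post by simp,
      List.dropLast_append_of_ne_nil this]
    simp
  obtain ⟨m, hm⟩ := Nat.exists_eq_add_of_le hkm
  have hpos : 1 ≤ k := by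
    rw [← hk]; exact List.length_pos_iff.2 h0
  have hYt : word (r'.take k) = .replicate k Y := by
    rw [word, List.map_take]; change (word r').take k = _
    rw [hY, List.take_replicate, min_eq_left hkm]
  have hYd : word (r'.drop k) = .replicate m Y := by
    rw [word, List.map_drop]; change (word r').drop k = _
    rw [hY, List.drop_replicate, hm, Nat.add_sub_cancel_left]
  have hw : word (r ++ r'.take k) = .replicate k U ++ .replicate k D ∨
      word (r ++ r'.take k) = .replicate k D ++ .replicate k U := by
    rw [word_append, hX, hYt]
    cases X <;> cases Y <;> simp_all
  have hword : word (pre ++ r :: r' :: post).flatten = word pre.flatten ++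
      (.replicate k X ++ (.replicate k Y ++ (.replicate m Y ++ word post.flatten))) := by
    rw [hfl]
    simp only [word_append, hX, hY, hm, List.replicate_add, List.append_assoc]
  have hsplit : ∃ a b, (pre ++ r :: r' :: post).flatten = a ++ ((r ++ r'.take k) ++ b) ∧
      pre.flatten ++ (r'.drop k ++ post.flatten) = a ++ b :=
    ⟨pre.flatten, r'.drop k ++ post.flatten, by
      rw [hfl, List.append_assoc, ← List.append_assoc (r'.take k), List.take_append_drop], rfl⟩
  have hdl : ∀ s ∈ post.dropLast, k ≤ s.length := fun s hs => hmin s <| by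
    have : post ≠ [] := by rintro rfl; simp at hs
    rw [show pre ++ r :: r' :: post = pre ++ [r, r'] ++ post by simp,
      List.dropLast_append_of_ne_nil this]
    simp [hs]
  have hpre : ∀ s ∈ pre, k ≤ s.length := fun s hs => hmin s <| by
    rw [List.dropLast_append_of_ne_nil (by simp)]; simp [hs]
  -- Without a run on the left, the walk starts at height zero. Hence `r` consists of up-steps and
  -- `r'` has exactly `k` down-steps.
  rcases pre.eq_nil_or_concat with rfl | ⟨pre', p, rfl⟩
  · have hXU : X = U ∧ Y = D := by
      rw [hword] at hd
      cases X <;> cases Y <;> simp_all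
      have := le_of_descends_replicate_D hd
      omega
    obtain ⟨rfl, rfl⟩ := hXU
    have hm0 : m = 0 := by
      rw [hword] at hd
      simp only [List.flatten_nil, word_nil, List.nil_append, descends_block] at hd
      simpa using le_of_descends_replicate_D hd
    subst hm0
    have hdrop : r'.drop k = [] := by simp at hm; simp [hm]
    refine ⟨hpos, hsplit, hw, ?_, ?_⟩
    · rw [hword, hdrop]
      exact .first _
    · rw [hdrop]
      exact minRun_flatten (isRuns_of_suffix (pre := [r, r']) hr) hdl
  · rw [List.concat_eq_append] at *
    obtain ⟨W, hp0, hW⟩ := hr.const p (by simp)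
    have hWX : W ≠ X := by
      have := (isRuns_of_suffix (pre := pre') (post := p :: r :: r' :: post) (by simpa using hr)).alt
      rw [← hk] at hX
      simp only [List.map_cons, List.isChain_cons_cons, content_eq h0 hX, content_eq hp0 hW] at this
      simpa using this.1
    have hWY : W = Y := step_eq_of_ne hWX hXY.symm
    subst hWY
    obtain ⟨p', hp'⟩ := Nat.exists_eq_add_of_le' (hpre p (by simp))
    have hpw : word p = .replicate p' W ++ .replicate k W := by
      rw [hW, hp', List.replicate_add]
    refine ⟨hpos, hsplit, hw, ?_, ?_⟩
    · rw [hword]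
      simp only [List.flatten_append, List.flatten_cons, List.flatten_nil, List.append_nil,
        word_append, hpw, hYd, List.append_assoc]
      rw [← List.append_assoc (word pre'.flatten), ← List.append_assoc (word pre'.flatten)]
      cases W <;> cases X <;> try exact absurd rfl hWX
      · exact .valley _ _
      · exact .peak _ _
    -- With two contents only, the run `p` before `r` has the content of `r'`, so `p` and the rest
    -- of `r'` form one run.
    · have hmerge : IsRuns (pre' ++ (p ++ r'.drop k) :: post) := by
        refine ⟨fun s hs => ?_, ?_⟩
        · simp only [List.mem_append, List.mem_cons] at hs
          rcases hs with hs | rfl | hs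
          · exact hr.const s (by simp [hs])
          · refine ⟨W, by simp [hp0], ?_⟩
            rw [word_append, hW, hYd, List.length_append, List.replicate_add]
            simp [hm]
          · exact hr.const s (by simp [hs])
        · have h1 := hr.alt
          have hc : content (p ++ r'.drop k) = some W := by
            rw [content, List.head?_append_of_ne_nil _ hp0]; exact content_eq hp0 hW
          simp only [List.append_assoc, List.cons_append, List.nil_append, List.map_append,
            List.map_cons, content_eq hp0 hW, content_eq h0' hY, hc] at h1 ⊢
          rw [List.isChain_append] at h1 ⊢
          refine ⟨h1.1, ?_, by simpa using h1.2.2⟩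
          exact (List.isChain_cons_cons.1 (List.isChain_cons_cons.1 h1.2.1).2).2
      have : (pre' ++ [p]).flatten ++ (r'.drop k ++ post.flatten) =
          (pre' ++ (p ++ r'.drop k) :: post).flatten := by simp
      rw [this]
      refine minRun_flatten hmerge fun s hs => ?_
      rw [List.dropLast_append_of_ne_nil (by simp), List.mem_append] at hs
      rcases hs with hs | hs
      · exact hpre s (by simp [hs])
      · by_cases hp : post = []
        · simp [hp] at hs
        · rw [List.dropLast_cons_of_ne_nil hp, List.mem_cons] at hs
          rcases hs with rfl | hs
          · have := hpre p (by simp)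
            rw [List.length_append]; omega
          · exact hdl s hs

theorem eq_nil_of_nextSoliton {l} (hd : Descends 0 (word l)) (h : nextSoliton l = none) :
    l = [] := by
  have hr := isRuns_runs l
  rw [nextSoliton] at h
  split at h
  · next h1 =>
    rw [List.min?_eq_none_iff, List.map_eq_nil_iff] at h1
    rw [← flatten_runs l] at hd ⊢
    rcases hrs : runs l with _ | ⟨r, _ | ⟨r', rs⟩⟩
    · rfl
    · rw [hrs] at hd hr
      obtain ⟨X, h0, hX⟩ := hr.const r (by simp)
      simp only [List.flatten_cons, List.flatten_nil, List.append_nil] at hd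
      have hl : r.length = 0 := by
        rw [hX] at hd
        cases X
        · exact eq_zero_of_descends_replicate_U hd
        · exact eq_of_descends_replicate_D hd
      exact absurd (List.length_eq_zero_iff.1 hl) h0
    · simp [hrs] at h1
  · next k h1 =>
    exact absurd h (takeSoliton_ne_none (List.min?_eq_some_iff.1 h1).1)

theorem identifies_nextSoliton {k₀ l γ} (hd : Descends 0 (word l)) (hk : MinRun k₀ l)
    (hs : l.Nodup) (h : nextSoliton l = some γ) :
    ∃ k, k₀ ≤ k ∧ Identifies k γ l (l.filter fun b => decide (b ∉ γ)) := by
  rw [nextSoliton] at h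
  split at h
  · cases h
  · next k h1 =>
    obtain ⟨hmem, hmin⟩ := List.min?_eq_some_iff.1 h1
    obtain ⟨pre, r, r', post, hrs, hlen, rfl⟩ := exists_of_takeSoliton h
    obtain ⟨s, hs', rfl⟩ := List.mem_map.1 hmem
    refine ⟨s.length, hk s hs', ?_⟩
    have hr := isRuns_runs l
    have hfl := flatten_runs l
    rw [hrs] at hr hfl
    have key := identifies_of_runs (k := s.length) hr (by rw [hfl]; exact hd) hlen
      fun t ht => hmin _ (List.mem_map_of_mem (by rw [hrs]; exact ht))
    rw [hfl] at key
    obtain ⟨a, b, h2, h3⟩ := key.split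
    -- As the boxes are distinct, filtering by membership removes precisely the segment occupied by
    -- the soliton.
    have : (l.filter fun b => decide (b ∉ r ++ r'.take s.length)) = a ++ b := by
      rw [h2] at hs ⊢
      generalize r ++ r'.take s.length = γ at hs
      rw [List.nodup_append, List.nodup_append] at hs
      have e1 : a.filter (fun b => decide (b ∉ γ)) = a := List.filter_eq_self.2 fun x hx => by
        simp only [decide_eq_true_eq]; exact fun hx' => hs.2.2 x hx x (by simp [hx']) rfl
      have e2 : b.filter (fun b => decide (b ∉ γ)) = b := List.filter_eq_self.2 fun x hx => by
        simp only [decide_eq_true_eq]; exact fun hx' => hs.2.1.2.2 x hx' x hx rfl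
      have e3 : γ.filter (fun b => decide (b ∉ γ)) = [] := by
        rw [List.filter_eq_nil_iff]; simp
      rw [List.filter_append, List.filter_append, e1, e2, e3, List.nil_append]
    rw [this, ← h3]
    exact key

/-! ### The succession of rounds: counting and nesting of solitons. -/

/-- The boxes are listed from left to right. -/
def Ordered (l : List Box) : Prop := l.Pairwise fun a b => a.2 < b.2

theorem Ordered.nodup {l} (h : Ordered l) : l.Nodup :=
  List.Pairwise.imp (S := (· ≠ ·))
    (fun {a b : Box} (hab : a.2 < b.2) => by rintro rfl; exact lt_irrefl _ hab) h

/-- The soliton `γ` is not larger than `δ`, and no box of `δ` lies between boxes of `γ`. -/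
def Inside (γ δ : List Box) : Prop :=
  γ.length ≤ δ.length ∧ ∀ d ∈ δ, (∀ c ∈ γ, d.2 < c.2) ∨ ∀ c ∈ γ, c.2 < d.2

/-- The shape of a soliton of size `k`. -/
def IsSoliton (k : ℕ) (γ : List Box) : Prop :=
  word γ = .replicate k U ++ .replicate k D ∨ word γ = .replicate k D ++ .replicate k U

theorem IsSoliton.length_eq {k γ} (h : IsSoliton k γ) : γ.length = 2 * k := by
  rw [← length_word]
  rcases h with h | h <;> rw [h] <;> simp <;> omega

/-- Induction along the rounds of the Takahashi–Satsuma algorithm. -/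
theorem identify_induction {P : ℕ → List Box → List (List Box) → Prop}
    (nil : ∀ k, P k [] [])
    (step : ∀ k₀ k γ l l' S, k₀ ≤ k → Ordered l → Identifies k γ l l' → P k l' S →
      P k₀ l (γ :: S)) (n l k) (hn : l.length ≤ n) (hd : Descends 0 (word l)) (ho : Ordered l)
    (hk : MinRun k l) : P k l (identify n l) := by
  induction n generalizing l k with
  | zero =>
    rw [List.length_eq_zero_iff.1 (Nat.le_zero.1 hn)]
    exact nil k
  | succ n ih =>
    rw [identify]
    split
    · next h =>
      rw [eq_nil_of_nextSoliton hd h]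
      exact nil k
    · next γ h =>
      obtain ⟨k', hk', hI⟩ := identifies_nextSoliton hd hk ho.nodup h
      refine step k k' γ l _ _ hk' ho hI (ih _ _ ?_ ((hI.removal.descends_iff 0).1 hd)
        (List.Pairwise.filter _ ho) hI.minRun)
      obtain ⟨a, b, h1, h2⟩ := hI.split
      have h3 := IsSoliton.length_eq hI.word_eq
      have := hI.pos
      rw [h2]
      rw [h1] at hn
      simp at hn ⊢
      omega

/-- Each round that removes a soliton of size `k` accounts for one peak of the `j`-th reduced word
if `j < k` and for none otherwise; at the end the word is empty. -/
theorem peaks_iterate_identify (n l k) (hn : l.length ≤ n) (hd : Descends 0 (word l))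
    (ho : Ordered l) (hk : MinRun k l) (j : ℕ) : peaks (elim^[j] (word l)) =
      (identify n l).countP fun γ => decide (2 * j < γ.length) := by
  refine identify_induction (P := fun _ l S => peaks (elim^[j] (word l)) =
    S.countP fun γ => decide (2 * j < γ.length)) (fun _ => ?_) ?_ n l k hn hd ho hk
  · have : elim^[j] [] = [] := Function.iterate_fixed elim_nil j
    simp [this]
  · intro k₀ k γ l l' S _ _ hI hP
    rw [hI.removal.peaks_iterate, hP, List.countP_cons, IsSoliton.length_eq hI.word_eq]
    simp

theorem mem_identify (n l k) (hn : l.length ≤ n) (hd : Descends 0 (word l))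
    (ho : Ordered l) (hk : MinRun k l) :
    ∀ γ ∈ identify n l, γ.Sublist l ∧ ∃ m, k ≤ m ∧ 1 ≤ m ∧ IsSoliton m γ := by
  refine identify_induction (P := fun k l S =>
    ∀ γ ∈ S, γ.Sublist l ∧ ∃ m, k ≤ m ∧ 1 ≤ m ∧ IsSoliton m γ) (fun _ => ?_) ?_ n l k hn hd ho hk
  · simp
  · intro k₀ k γ l l' S hk₀ _ hI hP δ hδ
    obtain ⟨a, b, rfl, rfl⟩ := hI.split
    rcases List.mem_cons.1 hδ with rfl | hδ
    · exact ⟨(List.sublist_append_left δ b).trans (List.sublist_append_right _ _),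
        k, hk₀, hI.pos, hI.word_eq⟩
    · obtain ⟨h1, m, h2, h3⟩ := hP δ hδ
      exact ⟨h1.trans (List.Sublist.append_left (List.sublist_append_right _ _) _),
        m, hk₀.trans h2, h3⟩

/-- When `γ` is identified, it is a contiguous segment of the remaining boxes, so that all boxes of
later solitons lie before or after it. The sizes do not decrease from round to round, because
`MinRun` is preserved. -/
theorem pairwise_identify (n l k) (hn : l.length ≤ n) (hd : Descends 0 (word l))
    (ho : Ordered l) (hk : MinRun k l) : (identify n l).Pairwise Inside := by
  refine (identify_induction (P := fun k l S => S.Pairwise Inside ∧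
    ∀ γ ∈ S, γ.Sublist l ∧ ∃ m, k ≤ m ∧ IsSoliton m γ) (fun _ => ?_) ?_ n l k hn hd ho hk).1
  · simp
  · intro k₀ k γ l l' S hk₀ ho hI hP
    obtain ⟨a, b, rfl, rfl⟩ := hI.split
    refine ⟨List.pairwise_cons.2 ⟨fun δ hδ => ?_, hP.1⟩, fun δ hδ => ?_⟩
    · obtain ⟨h1, m, h2, h3⟩ := hP.2 δ hδ
      refine ⟨?_, fun d hd => ?_⟩
      · rw [h3.length_eq, IsSoliton.length_eq hI.word_eq]; omega
      · rw [Ordered, List.pairwise_append, List.pairwise_append] at ho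
        rcases List.mem_append.1 (h1.subset hd) with hd | hd
        · exact .inl fun c hc => ho.2.2 d hd c (by simp [hc])
        · exact .inr fun c hc => ho.2.1.2.2 c hc d hd
    · rcases List.mem_cons.1 hδ with rfl | hδ
      · exact ⟨(List.sublist_append_left δ b).trans (List.sublist_append_right _ _),
          k, hk₀, hI.word_eq⟩
      · obtain ⟨h1, m, h2, h3⟩ := hP.2 δ hδ
        exact ⟨h1.trans (List.Sublist.append_left (List.sublist_append_right _ _) _),
          m, hk₀.trans h2, h3⟩

/-! ### The solitons of an excursion. -/

theorem word_boxes (ε : Excursion) : word (boxes ε) = ε.toList := by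
  simp [word, boxes]

theorem map_snd_boxes (ε : Excursion) :
    (boxes ε).map Prod.snd = List.range' 1 (boxes ε).length := by
  simp [boxes]

theorem ordered_boxes (ε : Excursion) : Ordered (boxes ε) := by
  have : ((boxes ε).map Prod.snd).Pairwise (· < ·) := by
    rw [map_snd_boxes]; exact List.pairwise_lt_range'
  exact List.pairwise_map.1 this

theorem mem_boxes {ε : Excursion} {b} (h : b ∈ boxes ε) :
    1 ≤ b.2 ∧ b.2 < (boxes ε).length + 1 := by
  have := List.mem_map_of_mem (f := Prod.snd) h
  rw [map_snd_boxes, List.mem_range'_1] at this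
  omega

theorem minRun_zero (l) : MinRun 0 l := fun _ _ => Nat.zero_le _

theorem descends_boxes (ε : Excursion) : Descends 0 (word (boxes ε)) := by
  rw [word_boxes]; exact descends_toList ε

theorem mem_solitons {ε : Excursion} {γ} (h : γ ∈ solitons ε) :
    γ.Sublist (boxes ε) ∧ ∃ m, 1 ≤ m ∧ IsSoliton m γ := by
  obtain ⟨h1, m, -, h2⟩ := mem_identify _ _ 0 le_rfl (descends_boxes ε) (ordered_boxes ε)
    (minRun_zero _) γ h
  exact ⟨h1, m, h2⟩

theorem pairwise_solitons (ε : Excursion) : (solitons ε).Pairwise Inside :=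
  pairwise_identify _ _ 0 le_rfl (descends_boxes ε) (ordered_boxes ε) (minRun_zero _)

theorem peaks_iterate_solitons (ε : Excursion) (j : ℕ) : peaks (elim^[j] ε.toList) =
    (solitons ε).countP fun γ => decide (2 * j < γ.length) := by
  rw [← word_boxes]
  exact peaks_iterate_identify _ _ 0 le_rfl (descends_boxes ε) (ordered_boxes ε) (minRun_zero _) j

/-- Peak elimination turns the `k + 1`-solitons into `k`-solitons and removes the `1`-solitons. -/
theorem numSolitons_succ (ε : Excursion) (j : ℕ) :
    numSolitons ε (j + 1) = ones (elim^[j] ε.toList) := by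
  rw [ones, ← Function.iterate_succ_apply' elim, peaks_iterate_solitons, peaks_iterate_solitons,
    numSolitons, solitonsOfSize, ← List.countP_eq_length_filter]
  have : ∀ γ ∈ solitons ε, ∃ m, γ.length = 2 * m := fun γ h => by
    obtain ⟨_, m, _, h⟩ := mem_solitons h
    exact ⟨m, h.length_eq⟩
  revert this
  generalize solitons ε = S
  intro this
  suffices H : S.countP (fun γ => decide (γ.length = 2 * (j + 1))) +
      S.countP (fun γ => decide (2 * (j + 1) < γ.length)) =
      S.countP (fun γ => decide (2 * j < γ.length)) by
    simp only [Nat.succ_eq_add_one]; omega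
  induction S with
  | nil => simp
  | cons γ S ih =>
    obtain ⟨m, hm⟩ := this γ (by simp)
    have := ih fun γ h => this γ (by simp [h])
    simp only [List.countP_cons, hm, decide_eq_true_eq]
    split_ifs <;> omega

theorem sum_solitons (ε : Excursion) (f : ℕ → ℕ) {M} (hM : (boxes ε).length < M) :
    ((solitons ε).map fun γ => f (γ.length / 2)).sum =
      ∑ m ∈ Finset.range M, f m * numSolitons ε m := by
  have : ∀ γ ∈ solitons ε, ∃ m < M, γ.length = 2 * m := fun γ h => by
    obtain ⟨h1, m, _, h⟩ := mem_solitons h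
    have := h1.length_le
    exact ⟨m, by rw [h.length_eq] at this; omega, h.length_eq⟩
  revert this
  simp only [numSolitons, solitonsOfSize]
  generalize solitons ε = S
  intro this
  induction S with
  | nil => simp
  | cons γ S ih =>
    obtain ⟨m, hm, h⟩ := this γ (by simp)
    rw [List.map_cons, List.sum_cons, ih fun γ h => this γ (by simp [h])]
    have h' : ∀ x ∈ Finset.range M, f x * ((γ :: S).filter fun γ => decide (γ.length = 2 * x)).length
        = (if x = m then f x else 0) +
          f x * (S.filter fun γ => decide (γ.length = 2 * x)).length := by
      intro x _
      rw [List.filter_cons]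
      by_cases hx : x = m
      · subst hx; simp [h]; ring
      · have : ¬ (m = x) := fun e => hx e.symm
        simp [h, hx, this]
    rw [Finset.sum_congr rfl h', Finset.sum_add_distrib, Finset.sum_ite_eq']
    simp [hm, h]

theorem length_head {k γ} (h : IsSoliton k γ) : (head γ).length = k := by
  have : (head γ).length = (word γ).count U := by
    rw [head, List.length_map, ← List.countP_eq_length_filter, word, List.count,
      List.countP_map]
    congr 1
  rw [this]
  rcases h with h | h <;> simp [h, List.count_replicate]

theorem length_tail {k γ} (h : IsSoliton k γ) : (tail γ).length = k := by
  have : (tail γ).length = (word γ).count D := by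
    rw [tail, List.length_map, ← List.countP_eq_length_filter, word, List.count,
      List.countP_map]
    congr 1
  rw [this]
  rcases h with h | h <;> simp [h, List.count_replicate]

theorem head_append_tail_perm (γ) : (head γ ++ tail γ).Perm (γ.map Prod.snd) := by
  rw [head, tail, ← List.map_append]
  refine List.Perm.map _ ?_
  have : (fun b : Box => decide (b.1 = D)) = fun b => !decide (b.1 = U) := by
    ext ⟨a, _⟩; cases a <;> rfl
  rw [this]
  exact List.filter_append_perm _ _

/-! ### Slots and the rows of the slot diagram. -/

/-- The positions of the `k`-slots that a soliton provides. -/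
def slotsOf (k : ℕ) (γ : List Box) : List ℕ := (head γ).drop k ++ (tail γ).drop k

theorem slotsOf_sublist (k γ) : (slotsOf k γ).Sublist (head γ ++ tail γ) :=
  (List.drop_sublist _ _).append (List.drop_sublist _ _)

theorem mem_slotsOf {k γ z} (h : z ∈ slotsOf k γ) : ∃ b ∈ γ, b.2 = z := by
  have := (head_append_tail_perm γ).subset ((slotsOf_sublist k γ).subset h)
  simpa using this

theorem slots_pairwise (ε : Excursion) (k) : (slots ε k).Pairwise (· < ·) :=
  List.Pairwise.filter _ List.pairwise_lt_range

/-- Different solitons share no box by `pairwise_solitons`, so the slots can be counted soliton by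
soliton. -/
theorem slots_perm (ε : Excursion) (k) :
    (slots ε k).Perm (0 :: (solitons ε).flatMap (slotsOf k)) := by
  have hpos : ∀ γ ∈ solitons ε, ∀ z ∈ slotsOf k γ, 1 ≤ z ∧ z < (boxes ε).length + 1 := by
    intro γ hγ z hz
    obtain ⟨b, hb, rfl⟩ := mem_slotsOf hz
    exact mem_boxes ((mem_solitons hγ).1.subset hb)
  refine (List.perm_ext_iff_of_nodup ((slots_pairwise ε k).imp fun h => h.ne) ?_).2 fun z => ?_
  · rw [List.nodup_cons, List.nodup_flatMap]
    refine ⟨fun h0 => ?_, fun γ hγ => ?_, ?_⟩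
    · obtain ⟨γ, hγ, h0⟩ := List.mem_flatMap.1 h0
      have := (hpos γ hγ 0 h0).1
      omega
    · refine List.Nodup.sublist (slotsOf_sublist k γ) ((head_append_tail_perm γ).nodup_iff.2 ?_)
      have := (List.pairwise_map.2 (ordered_boxes ε)).sublist
        ((mem_solitons hγ).1.map Prod.snd)
      exact this.imp fun h => h.ne
    · refine (pairwise_solitons ε).imp fun {γ δ} h z hz hz' => ?_
      obtain ⟨b, hb, rfl⟩ := mem_slotsOf hz
      obtain ⟨d, hd, he⟩ := mem_slotsOf hz'
      rcases h.2 d hd with h | h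
      · exact (h b hb).ne he
      · exact (h b hb).ne' he
  · rw [slots, List.mem_filter, List.mem_range, decide_eq_true_eq, List.mem_cons, List.mem_flatMap]
    have : (∃ γ ∈ solitons ε, z ∈ (head γ).drop k ∨ z ∈ (tail γ).drop k) ↔
        ∃ γ ∈ solitons ε, z ∈ slotsOf k γ := by simp [slotsOf]
    rw [this]
    refine ⟨fun h => h.2, fun h => ⟨?_, h⟩⟩
    rcases h with rfl | ⟨γ, hγ, hz⟩
    · omega
    · exact (hpos γ hγ z hz).2

/-- The number of `k`-slots. -/
theorem length_slots (ε : Excursion) (k) {M} (hM : (boxes ε).length < M) :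
    (slots ε k).length = 1 + ∑ m ∈ Finset.range M, 2 * (m - k) * numSolitons ε m := by
  rw [(slots_perm ε k).length_eq, List.length_cons, List.length_flatMap, add_comm,
    ← sum_solitons ε (fun m => 2 * (m - k)) hM]
  congr 2
  refine List.map_congr_left fun γ hγ => ?_
  obtain ⟨_, m, _, h⟩ := mem_solitons hγ
  rw [slotsOf, List.length_append, List.length_drop, List.length_drop, length_head h,
    length_tail h, h.length_eq, Nat.mul_div_cancel_left _ two_pos]
  ring

/-- Double counting: each member of `K` is counted for exactly one index. -/
theorem sum_length_filter {α} (s : ℕ) (P : ℕ → α → Prop) [∀ j, DecidablePred (P j)] (K : List α)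
    (h : ∀ γ ∈ K, ∃ j < s, P j γ ∧ ∀ i < s, P i γ → i = j) :
    ((List.range s).map fun j => (K.filter fun γ => decide (P j γ)).length).sum = K.length := by
  change ∑ j ∈ Finset.range s, (K.filter fun γ => decide (P j γ)).length = _
  induction K with
  | nil => simp
  | cons γ K ih =>
    obtain ⟨j, hj, h1, h2⟩ := h γ (by simp)
    have h' : ∀ x ∈ Finset.range s, ((γ :: K).filter fun γ => decide (P x γ)).length =
        (if x = j then 1 else 0) + (K.filter fun γ => decide (P x γ)).length := by
      intro x hx
      rw [List.filter_cons]
      by_cases hx' : x = j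
      · subst hx'; simp [h1]; ring
      · have : ¬ P x γ := fun e => hx' (h2 x (Finset.mem_range.1 hx) e)
        simp [hx', this]
    rw [Finset.sum_congr rfl h', Finset.sum_add_distrib, Finset.sum_ite_eq',
      ih fun γ h' => h γ (by simp [h'])]
    simp [hj]; ring

theorem lt_of_mem_slots {ε : Excursion} {k z} (h : z ∈ slots ε k) : z < (boxes ε).length + 1 :=
  List.mem_range.1 (List.mem_filter.1 h).1

theorem slotPos_eq {ε : Excursion} {k j} (h : j < (slots ε k).length) :
    slotPos ε k j = (slots ε k)[j] := by
  simp [slotPos, h]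

theorem slotPos_mono (ε : Excursion) (k) {i j} (h : i ≤ j) : slotPos ε k i ≤ slotPos ε k j := by
  by_cases hj : j < (slots ε k).length
  · rw [slotPos_eq hj, slotPos_eq (h.trans_lt hj)]
    rcases h.eq_or_lt with rfl | h
    · rfl
    · exact (List.pairwise_iff_getElem.1 (slots_pairwise ε k) i j _ _ h).le
  · rw [slotPos, slotPos, List.getD_eq_default (n := j) _ _ (not_lt.1 hj)]
    by_cases hi : i < (slots ε k).length
    · rw [List.getD_eq_getElem _ _ hi]
      exact (lt_of_mem_slots (List.getElem_mem hi)).le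
    · rw [List.getD_eq_default _ _ (not_lt.1 hi)]

/-- No `k`-slot lies between boxes of a `k`-soliton. -/
theorem outside_of_mem_slots {ε : Excursion} {k γ z} (hγ : γ ∈ solitonsOfSize ε k)
    (hz : z ∈ slots ε k) : (∀ c ∈ γ, z < c.2) ∨ ∀ c ∈ γ, c.2 < z := by
  obtain ⟨hγ, hlen⟩ := List.mem_filter.1 hγ
  rw [decide_eq_true_eq] at hlen
  rcases List.mem_cons.1 ((slots_perm ε k).subset hz) with rfl | hz
  · exact .inl fun c hc => (mem_boxes ((mem_solitons hγ).1.subset hc)).1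
  · obtain ⟨δ, hδ, hz⟩ := List.mem_flatMap.1 hz
    obtain ⟨d, hd, rfl⟩ := mem_slotsOf hz
    obtain ⟨_, m, _, hm⟩ := mem_solitons hδ
    have hkm : k < m := by
      by_contra hkm
      rw [slotsOf, List.drop_eq_nil_of_le (by rw [length_head hm]; omega),
        List.drop_eq_nil_of_le (by rw [length_tail hm]; omega)] at hz
      simp at hz
    have hlt : γ.length < δ.length := by rw [hlen, hm.length_eq]; omega
    -- Which of `γ` and `δ` was identified first is not known a priori, so the nesting relation is
    -- symmetrised; the strict inequality of sizes then decides.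
    have : Std.Symm fun γ δ => γ = δ ∨ Inside γ δ ∨ Inside δ γ :=
      ⟨fun _ _ h => h.imp Eq.symm Or.symm⟩
    have key := List.Pairwise.forall_of_forall
      (R := fun γ δ => γ = δ ∨ Inside γ δ ∨ Inside δ γ) (fun _ _ => Or.inl rfl)
      ((pairwise_solitons ε).imp
        (S := fun γ δ => γ = δ ∨ Inside γ δ ∨ Inside δ γ) fun h => .inr (.inl h)) hγ hδ
    rcases key with rfl | h | h
    · exact absurd hlt (lt_irrefl _)
    · exact h.2 d hd
    · exact absurd h.1 (not_le.2 hlt)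

/-- A box of `γ` lies between the slot at `0` and the end marker, hence between two consecutive slot
positions. No slot separates the boxes of `γ`, so the whole soliton lies there. -/
theorem exists_appended {ε : Excursion} {k γ} (hk : 1 ≤ k) (hγ : γ ∈ solitonsOfSize ε k) :
    ∃ j < (slots ε k).length, Appended ε k j γ ∧
      ∀ i < (slots ε k).length, Appended ε k i γ → i = j := by
  have hm := List.mem_filter.1 hγ
  have hne : γ ≠ [] := by
    rintro rfl
    have := hm.2
    simp at this; omega
  obtain ⟨b, hb⟩ := List.exists_mem_of_ne_nil _ hne
  have hbox : ∀ c ∈ γ, 1 ≤ c.2 ∧ c.2 < (boxes ε).length + 1 := fun c hc =>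
    mem_boxes ((mem_solitons hm.1).1.subset hc)
  have h0 : slotPos ε k 0 < b.2 := by
    have h0 : 0 ∈ slots ε k := (slots_perm ε k).symm.subset (by simp)
    obtain ⟨i, hi, hi0⟩ := List.mem_iff_getElem.1 h0
    have := slotPos_mono ε k (Nat.zero_le i)
    rw [slotPos_eq hi, hi0] at this
    have := (hbox b hb).1
    omega
  have hs : ¬ slotPos ε k (slots ε k).length < b.2 := by
    rw [slotPos, List.getD_eq_default _ _ le_rfl]
    have := (hbox b hb).2
    omega
  obtain ⟨j, hj, h1, h2⟩ : ∃ j < (slots ε k).length,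
      slotPos ε k j < b.2 ∧ ¬ slotPos ε k (j + 1) < b.2 := by
    by_contra! H
    have : ∀ j ≤ (slots ε k).length, slotPos ε k j < b.2 := fun j => by
      induction j with
      | zero => exact fun _ => h0
      | succ j ih => exact fun h => H j h (ih (by omega))
    exact hs (this _ le_rfl)
  refine ⟨j, hj, fun c hc => ⟨?_, ?_⟩, fun i hi hA => ?_⟩
  · rw [slotPos_eq hj] at h1 ⊢
    rcases outside_of_mem_slots hγ (List.getElem_mem hj) with h | h
    · exact h c hc
    · exact absurd (h b hb) (not_lt.2 h1.le)
  · by_cases hj' : j + 1 < (slots ε k).length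
    · rw [slotPos_eq hj'] at h2 ⊢
      rcases outside_of_mem_slots hγ (List.getElem_mem hj') with h | h
      · exact absurd (h b hb) h2
      · exact h c hc
    · rw [slotPos, List.getD_eq_default _ _ (not_lt.1 hj')]
      exact (hbox c hc).2
  · obtain ⟨h3, h4⟩ := hA b hb
    rcases lt_trichotomy i j with h | h | h
    · have := slotPos_mono ε k (show i + 1 ≤ j from h)
      omega
    · exact h
    · have := slotPos_mono ε k (show j + 1 ≤ i from h)
      omega

theorem sum_slotRow (ε : Excursion) {k} (hk : 1 ≤ k) : (slotRow ε k).sum = numSolitons ε k :=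
  sum_length_filter _ (Appended ε k) _ fun _ hγ => exists_appended hk hγ

theorem length_slotRow (ε : Excursion) (k) {M} (hM : (boxes ε).length < M) :
    (slotRow ε k).length = 1 + ∑ m ∈ Finset.range M, 2 * (m - k) * numSolitons ε m := by
  rw [slotRow, List.length_map, List.length_range, length_slots ε k hM]

/-! ### Sums over the words with a given reduced word -/

/-- Put `y` peaks in front of a word. -/
def addPeaks (y : ℕ) (w : List DyckStep) : List DyckStep := (fun l => U :: D :: l)^[y] w

theorem addPeaks_succ (y w) : addPeaks (y + 1) w = U :: D :: addPeaks y w :=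
  Function.iterate_succ_apply' _ _ _

theorem elim_addPeaks (y w) : elim (addPeaks y w) = elim w := by
  induction y with
  | zero => rfl
  | succ y ih => rw [addPeaks_succ, elim_UD, ih]

theorem ones_addPeaks (y w) : ones (addPeaks y w) = ones w + y := by
  induction y with
  | zero => rfl
  | succ y ih => rw [addPeaks_succ, ones_UD, ih, add_assoc]

/-- The word does not start with a peak. -/
def NoPeak (w : List DyckStep) : Prop := ∀ l, w ≠ U :: D :: l

theorem addPeaks_injective {y y' w w'} (hw : NoPeak w) (hw' : NoPeak w')
    (h : addPeaks y w = addPeaks y' w') : y = y' ∧ w = w' := by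
  induction y generalizing y' with
  | zero => cases y' with
    | zero => exact ⟨rfl, h⟩
    | succ y' => rw [addPeaks_succ] at h; exact absurd h (hw _)
  | succ y ih => cases y' with
    | zero => rw [addPeaks_succ] at h; exact absurd h.symm (hw' _)
    | succ y' =>
      rw [addPeaks_succ, addPeaks_succ] at h
      simp only [List.cons.injEq, true_and] at h
      exact (ih h).imp (congrArg _) id

theorem exists_addPeaks (w) : ∃ y w', NoPeak w' ∧ addPeaks y w' = w := by
  induction w using word_induction with
  | nil => exact ⟨0, _, fun _ => by simp, rfl⟩
  | single => exact ⟨0, _, fun _ => by simp, rfl⟩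
  | hD l => exact ⟨0, _, fun _ => by simp, rfl⟩
  | hUU l => exact ⟨0, _, fun _ => by simp, rfl⟩
  | hUD l ih =>
    obtain ⟨y, w', h, rfl⟩ := ih
    exact ⟨y + 1, w', h, addPeaks_succ _ _⟩

open Classical in
theorem tsum_eq_tsum_addPeaks (f : List DyckStep → ℝ≥0∞) :
    ∑' w, f w = ∑' y, ∑' w, if NoPeak w then f (addPeaks y w) else 0 := by
  let e : ℕ × {w // NoPeak w} ≃ List DyckStep := Equiv.ofBijective (fun p => addPeaks p.1 p.2)
    ⟨fun p p' h => by
      obtain ⟨h1, h2⟩ := addPeaks_injective p.2.2 p'.2.2 h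
      exact Prod.ext h1 (Subtype.ext h2),
     fun w => by
      obtain ⟨y, w', h, h'⟩ := exists_addPeaks w
      exact ⟨(y, ⟨w', h⟩), h'⟩⟩
  rw [← e.tsum_eq f, ENNReal.tsum_prod']
  refine tsum_congr fun y => ?_
  exact (tsum_subtype {w | NoPeak w} (fun w => f (addPeaks y w))).trans
    (tsum_congr fun w => by simp [Set.indicator_apply])

/-- The sum of `h` of the number of additional peaks over all words with reduced word `v`. -/
noncomputable def fibreSum (v : List DyckStep) (h : ℕ → ℝ≥0∞) : ℝ≥0∞ :=
  ∑' w, if elim w = v then h (ones w) else 0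

theorem fibreSum_nil (h) : fibreSum [] h = ∑' y, h y := by
  classical
  rw [fibreSum, tsum_eq_tsum_addPeaks]
  refine tsum_congr fun y => ?_
  rw [tsum_eq_single []]
  · rw [if_pos (show NoPeak [] from fun _ => by simp), elim_addPeaks, ones_addPeaks]; simp
  · intro w hw
    rw [elim_addPeaks]
    split_ifs with h1 h2
    · exfalso
      rcases w with _ | ⟨_ | _, _ | ⟨_ | _, w⟩⟩ <;> simp_all
      exact h1 _ rfl
    · rfl
    · rfl

/-- The word with first step `a` that starts with no peak and reduces to `a :: v`, made of a word
that reduces to `v`. -/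
def prependStep (a : DyckStep) (v w : List DyckStep) : List DyckStep :=
  if a = U ∧ v.head? = some D then a :: U :: D :: w else a :: w

theorem prependStep_injective (a v) : Function.Injective (prependStep a v) := by
  intro w w' h
  unfold prependStep at h
  split_ifs at h <;> simpa using h

theorem prependStep_spec (a v w) :
    (NoPeak (prependStep a v w) ∧ elim (prependStep a v w) = a :: v) ↔ elim w = v := by
  unfold prependStep NoPeak
  split_ifs with h
  · simp [h.1]
  · cases a with
    | D => simp
    | U =>
      simp only [true_and] at h
      rcases w with _ | ⟨_ | _, w⟩
      · simp
      · simp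
      · simp
        rintro rfl
        simp at h

theorem ones_prependStep {a v w} (h : elim w = v) : ones (prependStep a v w) = ones w := by
  unfold prependStep
  split_ifs with h'
  · obtain ⟨rfl, h'⟩ := h'
    cases v with
    | nil => simp at h'
    | cons b v =>
      simp only [List.head?_cons, Option.some.injEq] at h'
      subst h'
      simp [ones, h]
  · cases a with
    | D => simp
    | U =>
      simp only [true_and] at h'
      rcases w with _ | ⟨_ | _, w⟩
      · simp [ones]
      · rcases hv : elim (U :: w) with _ | ⟨_ | _, v'⟩
        · simp [ones, hv]
        · simp [ones, hv]
        · rw [hv] at h; simp [← h] at h'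
      · simp [← h] at h'

theorem exists_prependStep {a v w} (h : NoPeak w) (he : elim w = a :: v) :
    ∃ w', prependStep a v w' = w := by
  unfold prependStep
  rcases w with _ | ⟨_ | _, w⟩
  · simp at he
  · rcases w with _ | ⟨_ | _, w⟩
    · simp at he; simp [he]
    · simp only [elim_UU, List.cons.injEq] at he
      obtain ⟨rfl, he⟩ := he
      split_ifs with h'
      · rcases w with _ | ⟨_ | _, w⟩
        · simp [← he] at h'
        · simp [← he] at h'
        · exact ⟨w, rfl⟩
      · exact ⟨_, rfl⟩
    · exact absurd rfl (h w)
  · simp at he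
    obtain ⟨rfl, _⟩ := he
    simp

/-- The gap in front of `a` receives `y` free peaks, and `prependStep` matches the rest with the
words that reduce to `v`. A peak forced between an initial `U D` of `a :: v` replaces the one lost
there, so it does not change `ones`. -/
theorem fibreSum_cons (a v h) : fibreSum (a :: v) h = ∑' y, fibreSum v fun p => h (p + y) := by
  classical
  rw [fibreSum, tsum_eq_tsum_addPeaks]
  refine tsum_congr fun y => ?_
  simp only [elim_addPeaks, ones_addPeaks, fibreSum]
  rw [← (prependStep_injective a v).tsum_eq]
  · refine tsum_congr fun w => ?_
    have := prependStep_spec a v w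
    by_cases hw : elim w = v
    · obtain ⟨h1, h2⟩ := this.2 hw
      rw [if_pos h1, if_pos h2, if_pos hw, ones_prependStep hw]
    · rw [if_neg hw]
      split_ifs with h1 h2
      · exact absurd (this.1 ⟨h1, h2⟩) hw
      · rfl
      · rfl
  · intro w hw
    simp only [Function.mem_support] at hw
    split_ifs at hw with h1 h2
    · exact exists_prependStep h1 h2
    · exact absurd rfl hw
    · exact absurd rfl hw

theorem fibreSum_add (v h h') :
    fibreSum v (fun p => h p + h' p) = fibreSum v h + fibreSum v h' := by
  rw [fibreSum, fibreSum, fibreSum, ← ENNReal.tsum_add]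
  exact tsum_congr fun w => by split_ifs <;> simp

theorem fibreSum_mul (v c h) : fibreSum v (fun p => c * h p) = c * fibreSum v h := by
  rw [fibreSum, fibreSum, ← ENNReal.tsum_mul_left]
  exact tsum_congr fun w => by split_ifs <;> simp

theorem tsum_nat_mul_geometric (t : ℝ≥0∞) :
    ∑' y : ℕ, (y : ℝ≥0∞) * t ^ y = t * (1 - t)⁻¹ * (1 - t)⁻¹ := by
  -- Write `y` as the number of `i < y`, then exchange the two sums.
  have h1 : ∀ y : ℕ, (y : ℝ≥0∞) * t ^ y = ∑' i, if i < y then t ^ y else 0 := fun y => by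
    rw [tsum_eq_sum (s := Finset.range y), Finset.sum_congr rfl fun i hi =>
      if_pos (Finset.mem_range.1 hi)]
    · simp
    · intro i hi
      rw [if_neg (by simpa using hi)]
  simp_rw [h1]
  rw [ENNReal.tsum_comm]
  have h2 : ∀ i : ℕ, (∑' y : ℕ, if i < y then t ^ y else 0) = t * (1 - t)⁻¹ * t ^ i := fun i => by
    rw [← (add_left_injective (i + 1)).tsum_eq (f := fun y => if i < y then t ^ y else 0)]
    · rw [← ENNReal.tsum_geometric, ← ENNReal.tsum_mul_left, ← ENNReal.tsum_mul_right]
      refine tsum_congr fun j => ?_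
      exact (if_pos (show i < j + (i + 1) by omega)).trans (by ring)
    · intro y hy
      simp only [Function.mem_support] at hy
      split_ifs at hy with h
      · exact ⟨y - (i + 1), by simp; omega⟩
      · exact absurd rfl hy
  simp_rw [h2]
  rw [ENNReal.tsum_mul_left, ENNReal.tsum_geometric]

/-- One geometric series for each of the `|v| + 1` gaps. -/
theorem fibreSum_pow (t : ℝ≥0∞) (v) :
    fibreSum v (fun p => t ^ p) = (1 - t)⁻¹ ^ (v.length + 1) := by
  induction v with
  | nil => rw [fibreSum_nil, ENNReal.tsum_geometric]; simp
  | cons a v ih =>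
    have : ∀ y, fibreSum v (fun p => t ^ (p + y)) = t ^ y * fibreSum v (fun p => t ^ p) :=
      fun y => by
        rw [← fibreSum_mul]
        congr 1; ext p; ring
    rw [fibreSum_cons]
    simp_rw [this, ih]
    rw [ENNReal.tsum_mul_right, ENNReal.tsum_geometric, List.length_cons, pow_succ' _ (_ + 1)]

/-- Each gap contributes `t (1 - t)⁻¹` to the mean number of extra peaks. -/
theorem fibreSum_nat_mul_pow (t : ℝ≥0∞) (v) : fibreSum v (fun p => (p : ℝ≥0∞) * t ^ p) =
    (v.length + 1) * (t * (1 - t)⁻¹) * (1 - t)⁻¹ ^ (v.length + 1) := by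
  induction v with
  | nil => rw [fibreSum_nil, tsum_nat_mul_geometric]; simp
  | cons a v ih =>
    have : ∀ y, fibreSum v (fun p => ((p + y : ℕ) : ℝ≥0∞) * t ^ (p + y)) =
        t ^ y * fibreSum v (fun p => (p : ℝ≥0∞) * t ^ p) +
          (y * t ^ y) * fibreSum v (fun p => t ^ p) := fun y => by
      rw [← fibreSum_mul, ← fibreSum_mul, ← fibreSum_add]
      congr 1; ext p; push_cast; ring
    rw [fibreSum_cons]
    simp_rw [this]
    rw [ENNReal.tsum_add, ENNReal.tsum_mul_right, ENNReal.tsum_mul_right, ENNReal.tsum_geometric,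
      tsum_nat_mul_geometric, ih, fibreSum_pow, List.length_cons]
    push_cast; ring

/-! ### The statistics of the reduced words -/

/-- The number of `j + 1`-solitons of the excursion with steps `w`. -/
def count (w : List DyckStep) (j : ℕ) : ℕ := ones (elim^[j] w)

theorem count_succ (w j) : count w (j + 1) = count (elim w) j := rfl

theorem length_elim (w) : (elim w).length + 2 * peaks w = w.length := by
  induction w using word_induction <;> simp_all <;> omega

/-- An elimination shortens a word with a peak by at least two steps, and a word without peaks stays
without them. This bound allows finite products and sums cut off at the word length. -/
theorem count_eq_zero {w j} (h : w.length ≤ 2 * j) : count w j = 0 := by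
  induction j generalizing w with
  | zero =>
    rw [List.length_eq_zero_iff.1 (Nat.le_zero.1 h)]; rfl
  | succ j ih =>
    by_cases hp : peaks w = 0
    · have : ∀ i, peaks (elim^[i] w) = 0 := fun i => by
        induction i with
        | zero => exact hp
        | succ i ih =>
          rw [Function.iterate_succ_apply']
          exact Nat.le_zero.1 ((peaks_elim_le _).1.trans ih.le)
      rw [count, ones, this, Nat.zero_sub]
    · have := length_elim w
      exact ih (by omega)

theorem eq_replicate_of_peaks {w h} (hd : Descends h w) (hp : peaks w = 0) :
    w = .replicate h D := by
  induction w using word_induction generalizing h with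
  | nil => simp_all [Descends]
  | single => simp [Descends] at hd
  | hD l ih => cases h with
    | zero => simp [Descends] at hd
    | succ h =>
      rw [List.replicate_succ, ← ih hd (by simpa using hp)]
  | hUU l ih =>
    have := ih (h := h + 1) hd (by simpa using hp)
    simp [List.replicate_succ] at this
  | hUD l ih => simp at hp

theorem sum_count_add (w M) :
    ∑ j ∈ Finset.range M, count w j + peaks (elim^[M] w) = peaks w := by
  induction M with
  | zero => simp
  | succ M ih =>
    rw [Finset.sum_range_succ, count, ones, Function.iterate_succ_apply', ← ih]
    have := (peaks_elim_le (elim^[M] w)).1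
    omega

theorem iterate_elim_eq_nil {w M} (hd : Descends 0 w) (h : w.length ≤ 2 * M) :
    elim^[M] w = [] := by
  induction M generalizing w with
  | zero => exact List.length_eq_zero_iff.1 (Nat.le_zero.1 h)
  | succ M ih =>
    rw [Function.iterate_succ_apply]
    by_cases hp : peaks w = 0
    · have := eq_replicate_of_peaks hd hp
      subst this
      exact ih (by simp [Descends]) (by simp)
    · have := length_elim w
      exact ih ((descends_elim _ _).2 hd) (by omega)

/-- An elimination removes two steps per peak, and the peaks number as many as all the solitons; in
the reduced word each soliton is one size smaller. -/
theorem length_eq_sum_count {w M} (hd : Descends 0 w) (h : w.length ≤ 2 * M) :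
    w.length = ∑ j ∈ Finset.range M, 2 * (j + 1) * count w j := by
  induction M generalizing w with
  | zero => simpa using h
  | succ M ih =>
    have h1 := sum_count_add w (M + 1)
    rw [iterate_elim_eq_nil hd h, peaks_nil, add_zero] at h1
    have h2 := length_elim w
    have h3 : (elim w).length = ∑ j ∈ Finset.range M, 2 * (j + 1) * count (elim w) j := by
      by_cases hp : peaks w = 0
      · have := eq_replicate_of_peaks hd hp
        subst this
        exact ih (by simp [Descends]) (by simp)
      · exact ih ((descends_elim _ _).2 hd) (by omega)
    rw [← h2, h3, ← h1, Finset.sum_range_succ', Finset.sum_range_succ', mul_add, Finset.mul_sum,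
      ← add_assoc, ← Finset.sum_add_distrib]
    congr 1
    exact Finset.sum_congr rfl fun j _ => by rw [count_succ]; ring

/-! ### Partition functions with a marked statistic -/

/-- The weight of a word, with parameter `a j` for the `j + 1`-solitons. -/
noncomputable def wordWeight (a : ℕ → ℝ≥0∞) (w : List DyckStep) : ℝ≥0∞ :=
  ∏ j ∈ Finset.range w.length, a j ^ count w j

/-- A linear statistic: `b 0` plus `b (j + 1)` for each `j + 1`-soliton. -/
noncomputable def mark (b : ℕ → ℝ≥0∞) (w : List DyckStep) : ℝ≥0∞ :=
  b 0 + ∑ j ∈ Finset.range w.length, b (j + 1) * count w j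

theorem wordWeight_eq (a) {w M} (h : w.length ≤ M) :
    wordWeight a w = ∏ j ∈ Finset.range M, a j ^ count w j := by
  refine Finset.prod_subset (Finset.range_mono h) fun j _ hj => ?_
  rw [count_eq_zero (by simp at hj; omega), pow_zero]

theorem mark_eq (b) {w M} (h : w.length ≤ M) :
    mark b w = b 0 + ∑ j ∈ Finset.range M, b (j + 1) * count w j := by
  refine congrArg _ (Finset.sum_subset (Finset.range_mono h) fun j _ hj => ?_)
  rw [count_eq_zero (by simp at hj; omega), Nat.cast_zero, mul_zero]

theorem length_elim_le (w) : (elim w).length ≤ w.length := by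
  have := length_elim w
  omega

theorem wordWeight_step (a w) :
    wordWeight a w = a 0 ^ ones w * wordWeight (fun j => a (j + 1)) (elim w) := by
  rw [wordWeight_eq a (Nat.le_succ _), wordWeight_eq _ (length_elim_le w),
    Finset.prod_range_succ', mul_comm]
  rfl

theorem mark_step (b w) : mark b w =
    mark (fun j => if j = 0 then b 0 else b (j + 1)) (elim w) + b 1 * ones w := by
  rw [mark_eq b (Nat.le_succ _), mark_eq _ (length_elim_le w), Finset.sum_range_succ', add_assoc]
  rfl

/-- The sum of a linear statistic over all excursions. -/
noncomputable def markedSum (a b : ℕ → ℝ≥0∞) : ℝ≥0∞ :=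
  open Classical in ∑' w, if Descends 0 w then mark b w * wordWeight a w else 0

/-- The parameters after summation over the `1`-solitons. -/
noncomputable def shiftParam (a : ℕ → ℝ≥0∞) (j : ℕ) : ℝ≥0∞ :=
  a (j + 1) * (1 - a 0)⁻¹ ^ (2 * (j + 1))

/-- The statistic after summation over the `1`-solitons, which have parameter `t`. -/
noncomputable def shiftMark (t : ℝ≥0∞) (b : ℕ → ℝ≥0∞) : ℕ → ℝ≥0∞
  | 0 => b 0 + t * (1 - t)⁻¹ * b 1
  | j + 1 => b (j + 2) + 2 * (j + 1) * (t * (1 - t)⁻¹ * b 1)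

theorem wordWeight_shiftParam (a) {v} (hv : Descends 0 v) : wordWeight (shiftParam a) v =
    wordWeight (fun j => a (j + 1)) v * (1 - a 0)⁻¹ ^ v.length := by
  conv_rhs => rw [length_eq_sum_count hv (M := v.length) (by omega)]
  rw [wordWeight, wordWeight, ← Finset.prod_pow_eq_pow_sum, ← Finset.prod_mul_distrib]
  refine Finset.prod_congr rfl fun j _ => ?_
  rw [shiftParam, mul_pow, ← pow_mul]

/-- The mean number of `1`-solitons over the words that reduce to `v` is affine in `|v|`, hence
again a linear statistic of `v`. -/
theorem mark_shiftMark (t b) {v} (hv : Descends 0 v) : mark (shiftMark t b) v =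
    mark (fun j => if j = 0 then b 0 else b (j + 1)) v +
      b 1 * ((v.length + 1) * (t * (1 - t)⁻¹)) := by
  have : (v.length : ℝ≥0∞) = ∑ j ∈ Finset.range v.length, 2 * (j + 1) * (count v j : ℝ≥0∞) := by
    conv_lhs => rw [length_eq_sum_count hv (M := v.length) (by omega)]
    push_cast; rfl
  rw [this]
  simp only [mark, shiftMark, if_true, Nat.add_eq_zero_iff, one_ne_zero, and_false, if_false]
  have h2 : ∑ j ∈ Finset.range v.length,
      (b (j + 2) + 2 * ((j : ℝ≥0∞) + 1) * (t * (1 - t)⁻¹ * b 1)) * (count v j : ℝ≥0∞) =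
      ∑ j ∈ Finset.range v.length, b (j + 1 + 1) * (count v j : ℝ≥0∞) +
        b 1 * (t * (1 - t)⁻¹) *
          ∑ j ∈ Finset.range v.length, 2 * ((j : ℝ≥0∞) + 1) * (count v j : ℝ≥0∞) := by
    rw [Finset.mul_sum, ← Finset.sum_add_distrib]
    exact Finset.sum_congr rfl fun j _ => by ring
  rw [h2]
  ring

/-- Summation over the `1`-solitons. -/
theorem markedSum_step (a b) : markedSum a b =
    (1 - a 0)⁻¹ * markedSum (shiftParam a) (shiftMark (a 0) b) := by
  classical
  let b' : ℕ → ℝ≥0∞ := fun j => if j = 0 then b 0 else b (j + 1)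
  let a' : ℕ → ℝ≥0∞ := fun j => a (j + 1)
  have h1 : ∀ w, (if Descends 0 w then mark b w * wordWeight a w else 0) =
      ∑' v, if elim w = v then (if Descends 0 v then
        (mark b' v * wordWeight a' v) * a 0 ^ ones w +
          (b 1 * wordWeight a' v) * (ones w * a 0 ^ ones w) else 0) else 0 := fun w => by
    rw [tsum_eq_single (elim w) fun v hv => if_neg hv.symm, if_pos rfl]
    simp only [descends_elim]
    split_ifs
    · rw [mark_step, wordWeight_step]; ring
    · rfl
  rw [markedSum, tsum_congr h1, ENNReal.tsum_comm, markedSum, ← ENNReal.tsum_mul_left]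
  refine tsum_congr fun v => ?_
  by_cases hv : Descends 0 v
  · simp only [if_pos hv]
    change fibreSum v (fun p => (mark b' v * wordWeight a' v) * a 0 ^ p +
          (b 1 * wordWeight a' v) * (p * a 0 ^ p)) = _
    rw [fibreSum_add, fibreSum_mul, fibreSum_mul, fibreSum_pow, fibreSum_nat_mul_pow,
      mark_shiftMark _ _ hv, wordWeight_shiftParam _ hv]
    ring
  · simp [hv]

@[simp] theorem mark_nil (b) : mark b [] = b 0 := by simp [mark]
@[simp] theorem wordWeight_nil (a) : wordWeight a [] = 1 := by simp [wordWeight]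

theorem le_markedSum (a b) : b 0 ≤ markedSum a b := by
  classical
  refine le_trans ?_ (ENNReal.le_tsum [])
  simp [Descends]

theorem markedSum_zero (b) : markedSum 0 b = b 0 := by
  classical
  rw [markedSum, tsum_eq_single []]
  · simp [Descends]
  · intro w hw
    split_ifs with hd
    · have h := length_eq_sum_count hd (M := w.length) (by omega)
      have : ∃ j ∈ Finset.range w.length, count w j ≠ 0 := by
        by_contra! H
        rw [Finset.sum_eq_zero fun j hj => by rw [H j hj, mul_zero]] at h
        exact hw (List.length_eq_zero_iff.1 h)
      obtain ⟨j, hj, hj'⟩ := this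
      rw [wordWeight, Finset.prod_eq_zero hj (by simp [hj']), mul_zero]
    · rfl

/-- The parameters `α(q)`, indexed from zero. -/
noncomputable def alphaSeq (q : ℕ → ℝ≥0∞) (j : ℕ) : ℝ≥0∞ :=
  q j * ∏ l ∈ Finset.range j, (1 - q l) ^ (2 * (j - l))

/-- The factor with `l = 0` in `alphaSeq q (j + 1)` is `(1 - q 0) ^ (2 * (j + 1))`, which is exactly
what `shiftParam` cancels. -/
theorem shiftParam_alphaSeq {q : ℕ → ℝ≥0∞} (h : q 0 < 1) :
    shiftParam (alphaSeq q) = alphaSeq fun j => q (j + 1) := by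
  ext j
  have h1 : (1 - q 0) * (1 - q 0)⁻¹ = 1 :=
    ENNReal.mul_inv_cancel (tsub_pos_of_lt h).ne' (ENNReal.sub_ne_top ENNReal.one_ne_top)
  have h0 : alphaSeq q 0 = q 0 := by simp [alphaSeq]
  rw [shiftParam, h0, alphaSeq, alphaSeq, Finset.prod_range_succ']
  simp only [Nat.add_sub_add_right, Nat.sub_zero]
  rw [← mul_assoc, mul_assoc, ← mul_pow, h1, one_pow, mul_one]

/-- The statistic after summation over the solitons of size at most `M`. -/
noncomputable def iterMark (q b : ℕ → ℝ≥0∞) : ℕ → ℕ → ℝ≥0∞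
  | 0 => b
  | M + 1 => shiftMark (q M) (iterMark q b M)

theorem markedSum_alphaSeq {q : ℕ → ℝ≥0∞} (b) (M) (h : ∀ j < M, q j < 1) :
    markedSum (alphaSeq q) b = (∏ j ∈ Finset.range M, (1 - q j)⁻¹) *
      markedSum (alphaSeq fun j => q (j + M)) (iterMark q b M) := by
  induction M with
  | zero => simp [iterMark]
  | succ M ih =>
    rw [ih fun j hj => h j (by omega), markedSum_step, shiftParam_alphaSeq (by simpa using h M (by omega)),
      Finset.prod_range_succ, mul_assoc]
    have h0 : alphaSeq (fun j => q (j + M)) 0 = q M := by simp [alphaSeq]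
    simp only [h0, iterMark, add_right_comm _ 1 M]
    rfl

theorem wordWeight_mono {a a' : ℕ → ℝ≥0∞} (h : ∀ j, a j ≤ a' j) (w) :
    wordWeight a w ≤ wordWeight a' w :=
  Finset.prod_le_prod' fun j _ => pow_le_pow_left' (h j) _

theorem markedSum_mono {a a' : ℕ → ℝ≥0∞} (h : ∀ j, a j ≤ a' j) (b) :
    markedSum a b ≤ markedSum a' b := by
  classical
  refine ENNReal.tsum_le_tsum fun w => ?_
  split_ifs
  · gcongr
    exact wordWeight_mono h w
  · rfl

/-- Sums over the excursions with solitons of size at most `M`. -/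
theorem markedSum_eq_iSup_trunc (a b : ℕ → ℝ≥0∞) :
    markedSum a b = ⨆ M, markedSum (fun j => if j < M then a j else 0) b := by
  classical
  refine le_antisymm ?_ (iSup_le fun M => markedSum_mono (fun j => by split_ifs <;> simp) b)
  rw [markedSum, ENNReal.tsum_eq_iSup_sum]
  refine iSup_le fun s => ?_
  obtain ⟨M, hM⟩ : ∃ M, ∀ w ∈ s, w.length ≤ M :=
    ⟨s.sup List.length, fun w hw => Finset.le_sup (f := List.length) hw⟩
  refine le_iSup_of_le M (le_trans (le_of_eq (Finset.sum_congr rfl fun w hw => ?_))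
    (ENNReal.sum_le_tsum s))
  have : wordWeight a w = wordWeight (fun j => if j < M then a j else 0) w :=
    Finset.prod_congr rfl fun j hj => by
      simp only [if_pos ((Finset.mem_range.1 hj).trans_le (hM w hw))]
  rw [this]

theorem iterMark_congr {q q' : ℕ → ℝ≥0∞} (b) {M} (h : ∀ j < M, q j = q' j) :
    iterMark q b M = iterMark q' b M := by
  induction M with
  | zero => rfl
  | succ M ih => rw [iterMark, iterMark, ih fun j hj => h j (by omega), h M (by omega)]

/-- For `≤`, truncating `α` at `M` amounts to truncating `q` at `M`; after `M` steps all parameters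
vanish and only the empty word remains. For `≥`, the empty word alone gives the bound after `M`
steps. -/
theorem markedSum_eq_iSup {q : ℕ → ℝ≥0∞} (h : ∀ j, q j < 1) (b) : markedSum (alphaSeq q) b =
    ⨆ M, (∏ j ∈ Finset.range M, (1 - q j)⁻¹) * iterMark q b M 0 := by
  refine le_antisymm ?_ (iSup_le fun M => ?_)
  · rw [markedSum_eq_iSup_trunc]
    refine iSup_mono fun M => le_of_eq ?_
    let q' : ℕ → ℝ≥0∞ := fun j => if j < M then q j else 0
    have h1 : (fun j => if j < M then alphaSeq q j else 0) = alphaSeq q' := by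
      ext j
      simp only [alphaSeq, q']
      split_ifs with hj
      · refine congrArg _ (Finset.prod_congr rfl fun l hl => ?_)
        rw [if_pos ((Finset.mem_range.1 hl).trans hj)]
      · simp
    have h2 : (alphaSeq fun j => q' (j + M)) = 0 := by
      ext j; simp [alphaSeq, q']
    have h3 : ∀ j < M, q' j = q j := fun j hj => if_pos hj
    rw [h1, markedSum_alphaSeq b M fun j hj => by rw [h3 j hj]; exact h j, h2, markedSum_zero,
      iterMark_congr b h3]
    refine congrArg (· * _) (Finset.prod_congr rfl fun j hj => ?_)
    rw [h3 j (Finset.mem_range.1 hj)]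
  · rw [markedSum_alphaSeq b M fun j _ => h j]
    gcongr
    exact le_markedSum _ _

/-- The constant statistic `1`. -/
noncomputable def unitMark (j : ℕ) : ℝ≥0∞ := if j = 0 then 1 else 0

theorem mark_unitMark (w) : mark unitMark w = 1 := by
  simp [mark, unitMark]

theorem iterMark_unitMark (q M) : iterMark q unitMark M = unitMark := by
  induction M with
  | zero => rfl
  | succ M ih =>
    rw [iterMark, ih]
    ext j
    cases j <;> simp [shiftMark, unitMark]

theorem partition_eq_iSup {q : ℕ → ℝ≥0∞} (h : ∀ j, q j < 1) :
    markedSum (alphaSeq q) unitMark = ⨆ M, ∏ j ∈ Finset.range M, (1 - q j)⁻¹ := by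
  rw [markedSum_eq_iSup h]
  simp [iterMark_unitMark, unitMark]

/-- After `M` steps the next factor is `(1 - q M)⁻¹ = ⊤`, and the remaining factors are not zero. -/
theorem partition_eq_top {q : ℕ → ℝ≥0∞} {M} (h : ∀ j < M, q j < 1) (hM : 1 ≤ q M) :
    markedSum (alphaSeq q) unitMark = ⊤ := by
  rw [markedSum_alphaSeq _ M h, markedSum_step]
  have h0 : alphaSeq (fun j => q (j + M)) 0 = q M := by simp [alphaSeq]
  rw [h0, tsub_eq_zero_of_le hM, ENNReal.inv_zero, ENNReal.top_mul, ENNReal.mul_top]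
  · exact Finset.prod_ne_zero_iff.2 fun j _ =>
      ENNReal.inv_ne_zero.2 (ENNReal.sub_ne_top ENNReal.one_ne_top)
  · refine (lt_of_lt_of_le ?_ (le_markedSum _ _)).ne'
    rw [iterMark_unitMark]
    simp [shiftMark, unitMark]

/-- The length of the excursion plus one. -/
noncomputable def lengthMark (j : ℕ) : ℝ≥0∞ := if j = 0 then 1 else 2 * j

theorem mark_lengthMark {w} (hw : Descends 0 w) : mark lengthMark w = w.length + 1 := by
  conv_rhs => rw [length_eq_sum_count hw (M := w.length) (by omega)]
  simp [mark, lengthMark, add_comm]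

/-- After `M` steps an `m + 1`-soliton of the reduced word stands for an `m + 1 + M`-soliton, of
length `2 (m + 1 + M)`. The product bounds the contribution of the smaller solitons; both bounds are
carried together because the constant term is fed by the coefficient of the `1`-solitons. -/
theorem iterMark_lengthMark_le (q : ℕ → ℝ≥0∞) (M) :
    iterMark q lengthMark M 0 ≤
        ∏ j ∈ Finset.range M, (1 + 2 * (j + 1) * (q j * (1 - q j)⁻¹)) ∧
      ∀ m, iterMark q lengthMark M (m + 1) ≤ 2 * (m + 1 + M) *
        ∏ j ∈ Finset.range M, (1 + 2 * (j + 1) * (q j * (1 - q j)⁻¹)) := by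
  induction M with
  | zero => simp [iterMark, lengthMark]
  | succ M ih =>
    rw [Finset.prod_range_succ]
    set P := ∏ j ∈ Finset.range M, (1 + 2 * ((j : ℝ≥0∞) + 1) * (q j * (1 - q j)⁻¹))
    set c := q M * (1 - q M)⁻¹
    have h1 : iterMark q lengthMark M 1 ≤ 2 * (1 + M) * P := by simpa using ih.2 0
    constructor
    · calc iterMark q lengthMark (M + 1) 0
          = iterMark q lengthMark M 0 + c * iterMark q lengthMark M 1 := rfl
        _ ≤ P + c * (2 * (1 + M) * P) := by gcongr; exact ih.1
        _ = P * (1 + 2 * (M + 1) * c) := by ring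
    · intro m
      calc iterMark q lengthMark (M + 1) (m + 1)
          = iterMark q lengthMark M (m + 1 + 1) +
            2 * (m + 1) * (c * iterMark q lengthMark M 1) := rfl
        _ ≤ 2 * ((m + 1 : ℕ) + 1 + M) * P + 2 * (m + 1) * (c * (2 * (1 + M) * P)) := by
          gcongr; exact ih.2 (m + 1)
        _ ≤ 2 * (m + 1 + (M + 1 : ℕ)) * P +
            2 * (m + 1 + (M + 1 : ℕ)) * (c * (2 * (1 + M) * P)) := by
          gcongr ?_ + ?_
          · push_cast; apply le_of_eq; ring
          · gcongr 2 * ?_ * _; exact le_self_add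
        _ = 2 * (m + 1 + (M + 1 : ℕ)) * (P * (1 + 2 * (M + 1) * c)) := by ring

/-- Keeping only part of the length of the surviving soliton, step `M` adds at least `(M + 1) * q M`
to the constant term. -/
theorem le_iterMark_lengthMark (q : ℕ → ℝ≥0∞) (M) :
    ∑ j ∈ Finset.range M, (j + 1) * q j ≤ iterMark q lengthMark M 0 ∧
      ∀ m : ℕ, (m + 1 + M : ℝ≥0∞) ≤ iterMark q lengthMark M (m + 1) := by
  induction M with
  | zero =>
    simp only [Finset.range_zero, Finset.sum_empty, zero_le, iterMark, lengthMark, true_and]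
    intro m
    rw [if_neg (Nat.succ_ne_zero m), two_mul]
    push_cast
    rw [add_zero]
    exact le_self_add
  | succ M ih =>
    constructor
    · rw [Finset.sum_range_succ]
      refine add_le_add ih.1 ?_
      have h1 : (M + 1 : ℝ≥0∞) ≤ iterMark q lengthMark M 1 := by
        simpa [add_comm] using ih.2 0
      have h2 : 1 ≤ (1 - q M)⁻¹ := ENNReal.one_le_inv.2 tsub_le_self
      calc (M + 1) * q M = q M * 1 * (M + 1) := by ring
        _ ≤ q M * (1 - q M)⁻¹ * iterMark q lengthMark M 1 := by gcongr
    · intro m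
      refine le_trans (le_trans (le_of_eq ?_) (ih.2 (m + 1))) le_self_add
      push_cast; ring

/-! ### Finiteness of the partition function and of the mean length -/

theorem one_add_le_inv_one_sub (x : ℝ≥0∞) : 1 + x ≤ (1 - x)⁻¹ := by
  rw [← ENNReal.tsum_geometric]
  refine le_trans (le_of_eq ?_) (ENNReal.sum_le_tsum (Finset.range 2))
  simp [Finset.sum_range_succ]

theorem inv_one_sub_eq {x : ℝ≥0∞} (h : x < 1) : (1 - x)⁻¹ = 1 + x * (1 - x)⁻¹ := by
  have h1 : (1 - x) * (1 - x)⁻¹ = 1 :=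
    ENNReal.mul_inv_cancel (tsub_pos_of_lt h).ne' (ENNReal.sub_ne_top ENNReal.one_ne_top)
  calc (1 - x)⁻¹ = (1 - x + x) * (1 - x)⁻¹ := by rw [tsub_add_cancel_of_le h.le, one_mul]
    _ = 1 + x * (1 - x)⁻¹ := by rw [add_mul, h1]

theorem one_le_inv_one_sub (x : ℝ≥0∞) : 1 ≤ (1 - x)⁻¹ :=
  le_self_add.trans (one_add_le_inv_one_sub x)

theorem sum_le_prod_inv_one_sub (q : ℕ → ℝ≥0∞) (M) :
    1 + ∑ j ∈ Finset.range M, q j ≤ ∏ j ∈ Finset.range M, (1 - q j)⁻¹ := by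
  induction M with
  | zero => simp
  | succ M ih =>
    rw [Finset.sum_range_succ, Finset.prod_range_succ]
    calc 1 + (∑ j ∈ Finset.range M, q j + q M)
        ≤ 1 + (∑ j ∈ Finset.range M, q j + q M) + (∑ j ∈ Finset.range M, q j) * q M := le_self_add
      _ = (1 + ∑ j ∈ Finset.range M, q j) * (1 + q M) := by ring
      _ ≤ _ := mul_le_mul' ih (one_add_le_inv_one_sub _)

theorem exists_prod_one_add_le {f : ℕ → ℝ≥0∞} (h : ∑' j, f j < ⊤) :
    ∃ C < ⊤, ∀ M, ∏ j ∈ Finset.range M, (1 + f j) ≤ C := by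
  refine ⟨ENNReal.ofReal (Real.exp (∑' j, f j).toReal), ENNReal.ofReal_lt_top, fun M => ?_⟩
  have hf : ∀ j, f j ≠ ⊤ := ENNReal.ne_top_of_tsum_ne_top h.ne
  have h1 : ∀ j, 1 + f j = ENNReal.ofReal (1 + (f j).toReal) := fun j => by
    rw [ENNReal.ofReal_add zero_le_one ENNReal.toReal_nonneg, ENNReal.ofReal_one,
      ENNReal.ofReal_toReal (hf j)]
  simp_rw [h1]
  rw [← ENNReal.ofReal_prod_of_nonneg fun j _ => by positivity]
  refine ENNReal.ofReal_le_ofReal ((Real.prod_one_add_le_exp_sum _ fun _ => by positivity).trans ?_)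
  refine Real.exp_le_exp.2 ?_
  rw [← ENNReal.toReal_sum fun j _ => hf j]
  exact ENNReal.toReal_mono h.ne (ENNReal.sum_le_tsum _)

/-- Summability gives `q j ≤ 1/2` from some index on; finitely many finite values remain. -/
theorem exists_inv_one_sub_le {q : ℕ → ℝ≥0∞} (hq : ∀ j, q j < 1) (h : ∑' j, q j < ⊤) :
    ∃ R < ⊤, ∀ j, (1 - q j)⁻¹ ≤ R := by
  have h0 := ENNReal.tendsto_atTop_zero_of_tsum_ne_top h.ne
  obtain ⟨N, hN⟩ := Filter.eventually_atTop.1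
    (h0.eventually (ge_mem_nhds (show (0 : ℝ≥0∞) < 2⁻¹ by simp)))
  have hfin : ∀ j, (1 - q j)⁻¹ < ⊤ := fun j => ENNReal.inv_lt_top.2 (tsub_pos_of_lt (hq j))
  refine ⟨2 + ∑ j ∈ Finset.range N, (1 - q j)⁻¹, ENNReal.add_lt_top.2
    ⟨by simp, ENNReal.sum_lt_top.2 fun j _ => hfin j⟩, fun j => ?_⟩
  by_cases hj : j < N
  · exact le_add_of_nonneg_of_le zero_le
      (Finset.single_le_sum (f := fun j => (1 - q j)⁻¹) (fun _ _ => zero_le) (Finset.mem_range.2 hj))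
  · refine le_trans ?_ le_self_add
    rw [ENNReal.inv_le_iff_inv_le, ← ENNReal.one_sub_inv_two]
    exact tsub_le_tsub_left (hN j (not_lt.1 hj)) 1

theorem tsum_mul_inv_one_sub_lt_top {q c : ℕ → ℝ≥0∞} (hq : ∀ j, q j < 1) (h : ∑' j, q j < ⊤)
    (hc : ∑' j, c j * q j < ⊤) : ∑' j, c j * (q j * (1 - q j)⁻¹) < ⊤ := by
  obtain ⟨R, hR, hR'⟩ := exists_inv_one_sub_le hq h
  calc ∑' j, c j * (q j * (1 - q j)⁻¹) ≤ ∑' j, (c j * q j) * R :=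
        ENNReal.tsum_le_tsum fun j => by rw [← mul_assoc]; gcongr; exact hR' j
    _ = (∑' j, c j * q j) * R := ENNReal.tsum_mul_right
    _ < ⊤ := ENNReal.mul_lt_top hc hR

theorem exists_prod_inv_one_sub_le {q : ℕ → ℝ≥0∞} (hq : ∀ j, q j < 1) (h : ∑' j, q j < ⊤) :
    ∃ C < ⊤, ∀ M, ∏ j ∈ Finset.range M, (1 - q j)⁻¹ ≤ C := by
  have h1 := tsum_mul_inv_one_sub_lt_top (c := 1) hq h (by simpa using h)
  obtain ⟨C, hC, hC'⟩ := exists_prod_one_add_le h1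
  refine ⟨C, hC, fun M => le_trans (le_of_eq (Finset.prod_congr rfl fun j _ => ?_)) (hC' M)⟩
  rw [Pi.one_apply, one_mul, ← inv_one_sub_eq (hq j)]

theorem partition_lt_top_iff {q : ℕ → ℝ≥0∞} (hq : ∀ j, q j < 1) :
    markedSum (alphaSeq q) unitMark < ⊤ ↔ ∑' j, q j < ⊤ := by
  rw [partition_eq_iSup hq]
  constructor
  · refine fun h => lt_of_le_of_lt ?_ h
    rw [ENNReal.tsum_eq_iSup_nat]
    exact iSup_mono fun M => le_add_self.trans (sum_le_prod_inv_one_sub q M)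
  · intro h
    obtain ⟨C, hC, hC'⟩ := exists_prod_inv_one_sub_le hq h
    exact (iSup_le hC').trans_lt hC

theorem markedSum_lengthMark_lt_top_iff {q : ℕ → ℝ≥0∞} (hq : ∀ j, q j < 1) :
    markedSum (alphaSeq q) lengthMark < ⊤ ↔ ∑' j : ℕ, (j + 1) * q j < ⊤ := by
  rw [markedSum_eq_iSup hq]
  constructor
  · refine fun h => lt_of_le_of_lt ?_ h
    rw [ENNReal.tsum_eq_iSup_nat]
    refine iSup_mono fun M => (le_iterMark_lengthMark q M).1.trans ?_
    refine le_trans (le_of_eq (one_mul _).symm) (mul_le_mul_left ?_ _)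
    exact le_self_add.trans (sum_le_prod_inv_one_sub q M)
  · intro h
    have h' : ∑' j, q j < ⊤ := lt_of_le_of_lt (ENNReal.tsum_le_tsum fun j =>
      le_mul_of_one_le_left' le_add_self) h
    obtain ⟨C, hC, hC'⟩ := exists_prod_inv_one_sub_le hq h'
    have h2 : ∑' j : ℕ, 2 * ((j : ℝ≥0∞) + 1) * (q j * (1 - q j)⁻¹) < ⊤ := by
      refine tsum_mul_inv_one_sub_lt_top hq h' ?_
      simp_rw [mul_assoc (2 : ℝ≥0∞)]
      rw [ENNReal.tsum_mul_left]
      exact ENNReal.mul_lt_top (by simp) h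
    obtain ⟨C₂, hC₂, hC₂'⟩ := exists_prod_one_add_le h2
    exact (iSup_le fun M => mul_le_mul' (hC' M)
      ((iterMark_lengthMark_le q M).1.trans (hC₂' M))).trans_lt (ENNReal.mul_lt_top hC hC₂)

/-! ### Parameters indexed from one -/

/-- Real parameters, indexed from zero and with values in `ℝ≥0∞`. -/
noncomputable def ofSeq (a : ℕ+ → ℝ) (j : ℕ) : ℝ≥0∞ := ENNReal.ofReal (a j.succPNat)

theorem succPNat_surj (k : ℕ+) : ∃ j : ℕ, k = j.succPNat := ⟨k.natPred, (PNat.succPNat_natPred k).symm⟩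

theorem prod_Ico_succPNat (f : ℕ+ → ℝ) (j : ℕ) :
    ∏ l ∈ Finset.Ico 1 j.succPNat, f l = ∏ l ∈ Finset.range j, f l.succPNat := by
  refine Finset.prod_bij' (fun l _ => PNat.natPred l) (fun l _ => l.succPNat) ?_ ?_ ?_ ?_ ?_
  · intro l hl
    obtain ⟨i, rfl⟩ := succPNat_surj l
    simpa using hl
  · intro l hl
    simpa using hl
  · simp
  · simp
  · simp

theorem alphaOf_succPNat (q : ℕ+ → ℝ) (j : ℕ) : alphaOf q j.succPNat =
    q j.succPNat * ∏ l ∈ Finset.range j, (1 - q l.succPNat) ^ (2 * (j - l)) := by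
  rw [alphaOf, prod_Ico_succPNat (fun l => (1 - q l) ^ (2 * ((j.succPNat : ℕ) - (l : ℕ))))]
  simp

theorem ofReal_one_sub {x : ℝ} (hx : 0 ≤ x) : ENNReal.ofReal (1 - x) = 1 - ENNReal.ofReal x := by
  rw [ENNReal.ofReal_sub 1 hx, ENNReal.ofReal_one]

theorem ofSeq_alphaOf {q : ℕ+ → ℝ} {j : ℕ} (h : ∀ l < j, q l.succPNat ∈ Set.Ico (0 : ℝ) 1)
    (hj : 0 ≤ q j.succPNat) : ofSeq (alphaOf q) j = alphaSeq (ofSeq q) j := by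
  have hl : ∀ l ∈ Finset.range j, 0 ≤ 1 - q l.succPNat := fun l hl =>
    sub_nonneg.2 (h l (Finset.mem_range.1 hl)).2.le
  rw [ofSeq, alphaOf_succPNat, ENNReal.ofReal_mul hj,
    ENNReal.ofReal_prod_of_nonneg fun l h => pow_nonneg (hl l h) _, alphaSeq, ofSeq]
  refine congrArg _ (Finset.prod_congr rfl fun l hl' => ?_)
  rw [ENNReal.ofReal_pow (hl l hl'), ofReal_one_sub (h l (Finset.mem_range.1 hl')).1, ofSeq]

theorem ofSeq_lt_one {q : ℕ+ → ℝ} (hq : q ∈ params) (j) : ofSeq q j < 1 := by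
  rw [ofSeq, ENNReal.ofReal_lt_one]
  exact (hq _).2

theorem alphaOf_mem_params {q : ℕ+ → ℝ} (hq : q ∈ params) : alphaOf q ∈ params := by
  intro k
  have h1 : ∀ l, 0 ≤ 1 - q l := fun l => sub_nonneg.2 (hq l).2.le
  refine ⟨mul_nonneg (hq k).1 (Finset.prod_nonneg fun l _ => pow_nonneg (h1 l) _), ?_⟩
  refine lt_of_le_of_lt (mul_le_of_le_one_right (hq k).1 ?_) (hq k).2
  exact Finset.prod_le_one (fun l _ => pow_nonneg (h1 l) _) fun l _ =>
    pow_le_one₀ (h1 l) (by linarith [(hq l).1])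

theorem prod_one_sub_pos {q : ℕ+ → ℝ} {k : ℕ+} (h : ∀ l < k, q l < 1) :
    0 < ∏ l ∈ Finset.Ico 1 k, (1 - q l) ^ (2 * ((k : ℕ) - (l : ℕ))) :=
  Finset.prod_pos fun l hl => pow_pos (sub_pos.2 (h l (Finset.mem_Ico.1 hl).2)) _

theorem alphaOf_qOf_apply {α : ℕ+ → ℝ} {k : ℕ+} (h : ∀ l < k, qOf α l < 1) :
    alphaOf (qOf α) k = α k := by
  rw [alphaOf, qOf_eq α k, div_mul_cancel₀ _ (prod_one_sub_pos h).ne']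

theorem alphaOf_qOf {α : ℕ+ → ℝ} (h : qOf α ∈ params) : alphaOf (qOf α) = α :=
  funext fun _ => alphaOf_qOf_apply fun l _ => (h l).2

theorem qOf_alphaOf {q : ℕ+ → ℝ} (h : q ∈ params) : qOf (alphaOf q) = q := by
  funext k
  induction k using PNat.strongInductionOn with
  | _ k ih =>
    rw [qOf_eq, Finset.prod_congr rfl fun l hl => by rw [ih l (Finset.mem_Ico.1 hl).2], alphaOf,
      mul_div_cancel_right₀ _ (prod_one_sub_pos fun l _ => (h l).2).ne']

/-! ### The two families of measures -/

theorem length_boxes (ε : Excursion) : (boxes ε).length = ε.toList.length := by simp [boxes]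

theorem numSolitons_succPNat (ε : Excursion) (j : ℕ) :
    numSolitons ε j.succPNat = count ε.toList j := by
  rw [Nat.succPNat_coe, numSolitons_succ]; rfl

theorem finprod_succPNat (f : ℕ+ → ℝ) {M} (h : ∀ j, M ≤ j → f j.succPNat = 1) :
    ∏ᶠ k, f k = ∏ j ∈ Finset.range M, f j.succPNat := by
  rw [← finprod_comp_equiv Equiv.pnatEquivNat.symm]
  refine finprod_eq_prod_of_mulSupport_subset _ fun j hj => ?_
  by_contra hj'
  exact hj (h j (by simpa using hj'))

theorem weight_eq {α : ℕ+ → ℝ} (h : α ∈ params) (ε) :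
    weight α ε = wordWeight (ofSeq α) ε.toList := by
  rw [weight, finprod_succPNat (M := ε.toList.length),
    ENNReal.ofReal_prod_of_nonneg fun j _ => pow_nonneg (h _).1 _]
  · refine Finset.prod_congr rfl fun j _ => ?_
    rw [ENNReal.ofReal_pow (h _).1, numSolitons_succPNat]; rfl
  · intro j hj
    rw [numSolitons_succPNat, count_eq_zero (by omega), pow_zero]

theorem tsum_excursion (f : List DyckStep → ℝ≥0∞) :
    open Classical in ∑' ε : Excursion, f ε.toList = ∑' w, if Descends 0 w then f w else 0 := by
  classical
  rw [show (fun ε : Excursion => f ε.toList) =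
    (fun w : {w // Descends 0 w} => f w) ∘ excursionEquiv from rfl]
  refine (excursionEquiv.tsum_eq fun w : {w // Descends 0 w} => f w).trans ?_
  refine (tsum_subtype {w | Descends 0 w} f).trans (tsum_congr fun w => ?_)
  simp [Set.indicator_apply]

theorem Z_eq {α : ℕ+ → ℝ} (h : α ∈ params) : Z α = markedSum (ofSeq α) unitMark := by
  rw [Z, tsum_congr (weight_eq h), tsum_excursion, markedSum]
  simp only [mark_unitMark, one_mul]

theorem Z_ne_zero {α : ℕ+ → ℝ} (h : α ∈ params) : Z α ≠ 0 := by
  rw [Z_eq h]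
  refine (lt_of_lt_of_le ?_ (le_markedSum _ _)).ne'
  simp [unitMark]

theorem summable_iff_tsum_lt_top {f : ℕ+ → ℝ} (h : ∀ k, 0 ≤ f k) :
    Summable f ↔ ∑' j, ofSeq f j < ⊤ := by
  rw [← Equiv.pnatEquivNat.symm.summable_iff]
  constructor
  · intro hs
    have := ENNReal.ofReal_tsum_of_nonneg (f := f ∘ Equiv.pnatEquivNat.symm) (fun j => h _) hs
    refine lt_of_eq_of_lt this.symm ENNReal.ofReal_lt_top
  · intro hs
    refine (ENNReal.summable_toReal hs.ne).congr fun j => ?_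
    exact ENNReal.toReal_ofReal (h _)

theorem alphaOf_mem_setA_iff {q : ℕ+ → ℝ} (hq : q ∈ params) : alphaOf q ∈ setA ↔ q ∈ setQ := by
  have h1 : ofSeq (alphaOf q) = alphaSeq (ofSeq q) :=
    funext fun j => ofSeq_alphaOf (fun l _ => hq _) (hq _).1
  have h2 : alphaOf q ∈ setA ↔ Z (alphaOf q) < ⊤ := and_iff_right (alphaOf_mem_params hq)
  have h3 : q ∈ setQ ↔ Summable q := and_iff_right hq
  rw [h2, h3, Z_eq (alphaOf_mem_params hq), h1, partition_lt_top_iff (ofSeq_lt_one hq),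
    summable_iff_tsum_lt_top fun k => (hq k).1]

/-- If `M` is the first index with `q_M ≥ 1`, cutting `q` off after `M` lowers `α`, but the
partition function is already infinite. -/
theorem qOf_mem_params {α : ℕ+ → ℝ} (h : α ∈ setA) : qOf α ∈ params := by
  by_contra hq
  -- The exponents `2 (k - j)` are even, so no sign problem arises even beyond an index with `q_j >
  -- 1`; a vanishing denominator yields the value `0`.
  have h0 : ∀ k : ℕ+, 0 ≤ qOf α k := fun k => by
    rw [qOf_eq]
    refine div_nonneg (h.1 k).1 (Finset.prod_nonneg fun l _ => ?_)
    exact Even.pow_nonneg (even_two_mul _) _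
  have hex : ∃ j : ℕ, 1 ≤ qOf α j.succPNat := by
    by_contra! H
    refine hq fun k => ?_
    obtain ⟨j, rfl⟩ := succPNat_surj k
    exact ⟨h0 _, H j⟩
  classical
  obtain ⟨M, hM, hlt⟩ : ∃ M : ℕ, 1 ≤ qOf α M.succPNat ∧ ∀ j < M, qOf α j.succPNat < 1 :=
    ⟨Nat.find hex, Nat.find_spec hex, fun j hj => not_le.1 (Nat.find_min hex hj)⟩
  let q' : ℕ → ℝ≥0∞ := fun j => if j ≤ M then ofSeq (qOf α) j else 0
  have h1 : ∀ j, alphaSeq q' j ≤ ofSeq α j := fun j => by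
    by_cases hj : j ≤ M
    · have e1 : alphaSeq q' j = alphaSeq (ofSeq (qOf α)) j := by
        simp only [alphaSeq, q', if_pos hj]
        refine congrArg _ (Finset.prod_congr rfl fun l hl => ?_)
        rw [if_pos ((Finset.mem_range.1 hl).le.trans hj)]
      rw [e1, ← ofSeq_alphaOf (fun l hl => ⟨h0 _, hlt l (by omega)⟩) (h0 _), ofSeq,
        alphaOf_qOf_apply, ofSeq]
      intro l hl
      obtain ⟨i, rfl⟩ := succPNat_surj l
      exact hlt i (lt_of_lt_of_le (Nat.succPNat_lt_succPNat.1 hl) hj)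
    · simp [alphaSeq, q', hj]
  have h2 := partition_eq_top (q := q') (M := M) (fun j hj => by
    simp only [q', if_pos hj.le]
    rw [ofSeq, ENNReal.ofReal_lt_one]; exact hlt j hj) (by
    simp only [q', le_refl, if_true]
    rw [ofSeq, ENNReal.one_le_ofReal]; exact hM)
  have h3 := markedSum_mono h1 unitMark
  rw [h2, ← Z_eq h.1] at h3
  exact (h3.trans_lt h.2).ne rfl

theorem mem_setA_iff {α : ℕ+ → ℝ} : α ∈ setA ↔ qOf α ∈ setQ := by
  constructor
  · intro hα
    have hq := qOf_mem_params hα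
    rwa [← alphaOf_mem_setA_iff hq, alphaOf_qOf hq]
  · intro hq
    have := (alphaOf_mem_setA_iff hq.1).2 hq
    rwa [alphaOf_qOf hq.1] at this

/-- By Tonelli, this is the mean of the excursion length, as a `k`-soliton occupies `2k` boxes. -/
theorem tsum_rho {α : ℕ+ → ℝ} (h : α ∈ params) : ∑' k : ℕ+, 2 * (k : ℝ≥0∞) * rho α k =
    (∑' ε : Excursion, (ε.toList.length : ℝ≥0∞) * wordWeight (ofSeq α) ε.toList) * (Z α)⁻¹ := by
  have h1 : ∀ ε : Excursion, ∑' k : ℕ+, 2 * (k : ℝ≥0∞) * numSolitons ε k = ε.toList.length :=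
    fun ε => by
      rw [← Equiv.pnatEquivNat.symm.tsum_eq, tsum_eq_sum (s := Finset.range ε.toList.length)]
      · conv_rhs => rw [length_eq_sum_count (descends_toList ε) (M := ε.toList.length) (by omega)]
        push_cast
        refine Finset.sum_congr rfl fun j _ => ?_
        simp [numSolitons_succ, count]
      · intro j hj
        have := count_eq_zero (w := ε.toList) (j := j) (by simp at hj; omega)
        simpa [numSolitons_succ, count] using this
  simp_rw [rho, ← ENNReal.tsum_mul_left]
  rw [ENNReal.tsum_comm, ← ENNReal.tsum_mul_right]
  refine tsum_congr fun ε => ?_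
  rw [← h1 ε, ← ENNReal.tsum_mul_right, ← ENNReal.tsum_mul_right]
  refine tsum_congr fun k => ?_
  rw [nu, weight_eq h, div_eq_mul_inv]
  ring

/-- The extra one in `lengthMark` adds the finite number `Z α` to the unnormalised mean length. -/
theorem mem_setAplus_iff_markedSum {α : ℕ+ → ℝ} (h : α ∈ setA) :
    α ∈ setAplus ↔ markedSum (ofSeq α) lengthMark < ⊤ := by
  classical
  have h1 : markedSum (ofSeq α) lengthMark =
      (∑' ε : Excursion, (ε.toList.length : ℝ≥0∞) * wordWeight (ofSeq α) ε.toList) + Z α := by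
    rw [Z_eq h.1, tsum_excursion fun w => (w.length : ℝ≥0∞) * wordWeight (ofSeq α) w, markedSum,
      markedSum, ← ENNReal.tsum_add]
    refine tsum_congr fun w => ?_
    split_ifs with hw
    · rw [mark_lengthMark hw, mark_unitMark]; ring
    · simp
  have h2 : α ∈ setAplus ↔ ∑' k : ℕ+, 2 * (k : ℝ≥0∞) * rho α k < ⊤ := and_iff_right h
  rw [h2, tsum_rho h.1, h1, ENNReal.add_lt_top, and_iff_left h.2]
  constructor
  · intro hlt
    by_contra htop
    rw [not_lt_top_iff.1 htop, ENNReal.top_mul (ENNReal.inv_ne_zero.2 h.2.ne)] at hlt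
    exact hlt.ne rfl
  · exact fun hlt => ENNReal.mul_lt_top hlt (ENNReal.inv_lt_top.2 (pos_iff_ne_zero.2 (Z_ne_zero h.1)))

theorem setQplus_subset_setQ : setQplus ⊆ setQ := fun q hq =>
  ⟨hq.1, Summable.of_nonneg_of_le (fun k => (hq.1 k).1) (fun k =>
    le_mul_of_one_le_left (hq.1 k).1 (by exact_mod_cast k.pos)) hq.2⟩

theorem alphaOf_mem_setAplus_iff {q : ℕ+ → ℝ} (hq : q ∈ params) :
    alphaOf q ∈ setAplus ↔ q ∈ setQplus := by
  by_cases hQ : q ∈ setQ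
  · have h1 : ofSeq (alphaOf q) = alphaSeq (ofSeq q) :=
      funext fun j => ofSeq_alphaOf (fun l _ => hq _) (hq _).1
    have h3 : q ∈ setQplus ↔ Summable fun k : ℕ+ => (k : ℝ) * q k := and_iff_right hq
    rw [mem_setAplus_iff_markedSum ((alphaOf_mem_setA_iff hq).2 hQ), h1,
      markedSum_lengthMark_lt_top_iff (ofSeq_lt_one hq), h3,
      summable_iff_tsum_lt_top fun k => mul_nonneg (Nat.cast_nonneg _) (hq k).1]
    refine iff_of_eq (congrArg (· < ⊤) (tsum_congr fun j => ?_))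
    rw [ofSeq, ofSeq, ENNReal.ofReal_mul (Nat.cast_nonneg _), ENNReal.ofReal_natCast]
    simp
  · exact iff_of_false (fun h => hQ ((alphaOf_mem_setA_iff hq).1 h.1))
      fun h => hQ (setQplus_subset_setQ h)

theorem mem_setAplus_iff {α : ℕ+ → ℝ} : α ∈ setAplus ↔ qOf α ∈ setQplus := by
  constructor
  · intro hα
    have hq := qOf_mem_params hα.1
    rwa [← alphaOf_mem_setAplus_iff hq, alphaOf_qOf hq]
  · intro hq
    have := (alphaOf_mem_setAplus_iff hq.1).2 hq
    rwa [alphaOf_qOf hq.1] at this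

/-! ### Regrouping of `φ_q` and equality of the two laws. -/

/-- The exponents of `1 - q` in `φ_q`, apart from the record `0`. -/
theorem length_slotRow_succPNat (ε : Excursion) (j : ℕ) : (slotRow ε j.succPNat).length =
    1 + ∑ i ∈ Finset.range ε.toList.length, 2 * (i - j) * count ε.toList i := by
  rw [length_slotRow ε _ (M := ε.toList.length + 1) (by rw [length_boxes]; omega),
    Finset.sum_range_succ']
  simp [numSolitons_succ, count]

/-- Exchange of the double product over `l < j`. Truncated subtraction makes the exponent vanish for
the other pairs, so both indices may run up to `M`. -/
theorem prod_alphaOf_pow (q : ℕ+ → ℝ) (n : ℕ → ℕ) (M : ℕ) :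
    ∏ j ∈ Finset.range M, alphaOf q j.succPNat ^ n j =
      ∏ j ∈ Finset.range M, q j.succPNat ^ n j *
        (1 - q j.succPNat) ^ ∑ i ∈ Finset.range M, 2 * (i - j) * n i := by
  rw [Finset.prod_mul_distrib]
  have h1 : ∀ j ∈ Finset.range M, alphaOf q j.succPNat ^ n j = q j.succPNat ^ n j *
      ∏ l ∈ Finset.range M, (1 - q l.succPNat) ^ (2 * (j - l) * n j) := fun j hj => by
    rw [alphaOf_succPNat, mul_pow, ← Finset.prod_pow]
    refine congrArg _ ?_
    simp_rw [← pow_mul]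
    refine Finset.prod_subset (Finset.range_mono (Finset.mem_range.1 hj).le) fun l _ hl => ?_
    rw [Nat.sub_eq_zero_of_le (by simpa using hl), mul_zero, zero_mul, pow_zero]
  rw [Finset.prod_congr rfl h1, Finset.prod_mul_distrib, Finset.prod_comm]
  simp_rw [Finset.prod_pow_eq_pow_sum]

/-- The summand `1` of each `s_k` (record `0`) splits off as an infinite product independent of `ε`;
it converges since `q` is summable. The remaining factors equal `1` from index `M` on. -/
theorem phi_eq {q : ℕ+ → ℝ} (hq : q ∈ setQ) (ε) : phi q ε =
    weight (alphaOf q) ε * ENNReal.ofReal (∏' j : ℕ, (1 - q j.succPNat)) := by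
  have hs : Summable fun j : ℕ => -q j.succPNat :=
    (Equiv.pnatEquivNat.symm.summable_iff.2 hq.2).neg
  have hm : Multipliable fun j : ℕ => 1 - q j.succPNat := by
    simpa [sub_eq_add_neg] using Real.multipliable_one_add_of_summable hs
  set M := ε.toList.length
  let f : ℕ → ℝ := fun j => q j.succPNat ^ count ε.toList j *
    (1 - q j.succPNat) ^ ∑ i ∈ Finset.range M, 2 * (i - j) * count ε.toList i
  have hf : ∀ j ∉ Finset.range M, f j = 1 := fun j hj => by
    have hj' : M ≤ j := by simpa using hj
    simp only [f]
    rw [count_eq_zero (by omega), Finset.sum_eq_zero fun i hi => by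
      rw [Nat.sub_eq_zero_of_le ((Finset.mem_range.1 hi).le.trans hj'), mul_zero, zero_mul]]
    simp
  have hmf : Multipliable f := multipliable_of_ne_finset_one hf
  have h1 : ∏' k : ℕ+, q k ^ (slotRow ε k).sum * (1 - q k) ^ (slotRow ε k).length =
      (∏ j ∈ Finset.range M, f j) * ∏' j : ℕ, (1 - q j.succPNat) := by
    rw [← tprod_eq_prod (L := .unconditional ℕ) hf, ← hmf.tprod_mul hm, ← Equiv.pnatEquivNat.symm.tprod_eq]
    refine tprod_congr fun j => ?_
    change q j.succPNat ^ (slotRow ε j.succPNat).sum *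
      (1 - q j.succPNat) ^ (slotRow ε j.succPNat).length = _
    rw [sum_slotRow ε j.succPNat.pos, numSolitons_succPNat, length_slotRow_succPNat, pow_add,
      pow_one]
    simp only [f]
    ring
  have hf0 : ∀ j, 0 ≤ f j := fun j =>
    mul_nonneg (pow_nonneg (hq.1 _).1 _) (pow_nonneg (sub_nonneg.2 (hq.1 _).2.le) _)
  rw [phi, h1, ENNReal.ofReal_mul (Finset.prod_nonneg fun j _ => hf0 j), ← prod_alphaOf_pow, weight,
    finprod_succPNat (M := M)]
  · simp_rw [numSolitons_succPNat]
  · intro j hj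
    rw [numSolitons_succPNat, count_eq_zero (by omega), pow_zero]

/-- Both sides are limits of the same partial products, as inversion is continuous on `ℝ≥0∞`. -/
theorem inv_Z_alphaOf {q : ℕ+ → ℝ} (hq : q ∈ setQ) :
    (Z (alphaOf q))⁻¹ = ENNReal.ofReal (∏' j : ℕ, (1 - q j.succPNat)) := by
  have hs : Summable fun j : ℕ => -q j.succPNat :=
    (Equiv.pnatEquivNat.symm.summable_iff.2 hq.2).neg
  have hm : Multipliable fun j : ℕ => 1 - q j.succPNat := by
    simpa [sub_eq_add_neg] using Real.multipliable_one_add_of_summable hs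
  have h1 : ofSeq (alphaOf q) = alphaSeq (ofSeq q) :=
    funext fun j => ofSeq_alphaOf (fun l _ => hq.1 _) (hq.1 _).1
  have hmono : Monotone fun M => ∏ j ∈ Finset.range M, (1 - ofSeq q j)⁻¹ :=
    monotone_nat_of_le_succ fun M => by
      rw [Finset.prod_range_succ]
      exact le_mul_of_one_le_right' (one_le_inv_one_sub _)
  have h2 := (continuous_inv.tendsto _).comp (tendsto_atTop_iSup hmono)
  rw [← partition_eq_iSup (ofSeq_lt_one hq.1), ← h1, ← Z_eq (alphaOf_mem_params hq.1)] at h2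
  have h3 := (ENNReal.continuous_ofReal.tendsto _).comp hm.hasProd.tendsto_prod_nat
  refine tendsto_nhds_unique h2 (h3.congr fun M => ?_)
  simp only [Function.comp_apply]
  rw [ENNReal.ofReal_prod_of_nonneg fun j _ => sub_nonneg.2 (hq.1 _).2.le,
    ← ENNReal.prod_inv_distrib, inv_inv]
  · exact Finset.prod_congr rfl fun j _ => ofReal_one_sub (hq.1 _).1
  · intro i _ j _ _
    exact .inl (ne_of_gt (tsub_pos_of_lt (ofSeq_lt_one hq.1 _)))

theorem nu_alphaOf {q : ℕ+ → ℝ} (hq : q ∈ setQ) : nu (alphaOf q) = phi q := by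
  funext ε
  rw [phi_eq hq, nu, ← inv_Z_alphaOf hq, div_eq_mul_inv]

theorem tsum_nu {α : ℕ+ → ℝ} (h : α ∈ setA) : ∑' ε, nu α ε = 1 := by
  simp_rw [nu, div_eq_mul_inv]
  rw [ENNReal.tsum_mul_right]
  exact ENNReal.mul_inv_cancel (Z_ne_zero h.1) h.2.ne

end BoxBall
open BoxBall in
theorem theorem1 :
    -- for parameters related by `q = q(α)`, or by `α = α(q)`
    (∀ α ∈ params, (α ∈ setA ↔ qOf α ∈ setQ)) ∧
    (∀ q ∈ params, (alphaOf q ∈ setA ↔ q ∈ setQ)) ∧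
    (∀ α ∈ params, (α ∈ setAplus ↔ qOf α ∈ setQplus)) ∧
    (∀ q ∈ params, (alphaOf q ∈ setAplus ↔ q ∈ setQplus)) ∧
    -- the transformations are inverse to each other and bijective between the parameter sets
    (∀ q ∈ params, qOf (alphaOf q) = q) ∧
    (∀ α ∈ params, qOf α ∈ params → alphaOf (qOf α) = α) ∧
    Set.BijOn qOf setA setQ ∧ Set.BijOn alphaOf setQ setA ∧
    Set.BijOn qOf setAplus setQplus ∧ Set.BijOn alphaOf setQplus setAplus ∧
    -- the two families consist of the same probability measures
    (∀ α ∈ setA, nu α = phi (qOf α) ∧ ∑' ε, nu α ε = 1) ∧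
    (∀ q ∈ setQ, nu (alphaOf q) = phi q ∧ ∑' ε, phi q ε = 1) := by
  have hinv : Set.InvOn alphaOf qOf setA setQ :=
    ⟨fun α h => alphaOf_qOf (qOf_mem_params h), fun q h => qOf_alphaOf h.1⟩
  have hinv' : Set.InvOn alphaOf qOf setAplus setQplus :=
    ⟨fun α h => alphaOf_qOf (qOf_mem_params h.1), fun q h => qOf_alphaOf h.1⟩
  have h1 : Set.MapsTo qOf setA setQ := fun α h => mem_setA_iff.1 h
  have h2 : Set.MapsTo alphaOf setQ setA := fun q h => (alphaOf_mem_setA_iff h.1).2 h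
  have h3 : Set.MapsTo qOf setAplus setQplus := fun α h => mem_setAplus_iff.1 h
  have h4 : Set.MapsTo alphaOf setQplus setAplus := fun q h => (alphaOf_mem_setAplus_iff h.1).2 h
  refine ⟨fun _ _ => mem_setA_iff, fun _ => alphaOf_mem_setA_iff, fun _ _ => mem_setAplus_iff,
    fun _ => alphaOf_mem_setAplus_iff, fun _ => qOf_alphaOf, fun _ _ => alphaOf_qOf,
    hinv.bijOn h1 h2, hinv.symm.bijOn h2 h1, hinv'.bijOn h3 h4, hinv'.symm.bijOn h4 h3,
    fun α h => ⟨?_, tsum_nu h⟩, fun q h => ⟨nu_alphaOf h, ?_⟩⟩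
  · rw [← nu_alphaOf (h1 h), alphaOf_qOf (qOf_mem_params h)]
  · rw [← nu_alphaOf h]
    exact tsum_nu (h2 h)
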